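/- All graphs are finite and simple. The edge deck of $G$ is the multiset of isomorphism classes of the graphs $G-e$, $e\in E(G)$; $G$ is edge-reconstructible if every graph with the same edge deck is isomorphic to $G$. Let $G$ be a connected graph of minimal degree $\delta\ge 2$ without cut vertices such that every card $G-e$ is connected and has at most one vertex of degree $\delta-1$. Let $a\omega$ be an edge of $G$ such that $a$ has degree $\delta-1$ in the card $K=G-a\omega$. If $\delta\ge3$, put $H=K$ and $\alpha=a$; if $\delta=2$, put $H=K-a$ and let $\alpha$ be the unique neighbour of $a$ in $K$. For a vertex $\omega'$ let $K+a\omega'$ be $K$ with the edge $a\omega'$ added. A minimal loop of $K+a\omega'$ is an embedded closed walk (cycle) in it, based at $\alpha$, that traverses the edge from $a$ to $\omega'$ in this direction, and is of minimal length among such walks. Let $v\ne\alpha$ be a vertex of $H$ with $\deg_H v\ge3$ and, if $v$ is adjacent to $\alpha$ in $H$, $\deg_H\alpha\ge3$. A special spanning tree for $v$ is a spanning tree $T$ of $H$ for which there are an edge $e_1\notin T$ of $H$ incident with $\alpha$ and an edge $e_v\notin T$ of $H$ that joins $v$ to a vertex different from $\alpha$. Let $e_1,\dots,e_{b-1}$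 be the edges of $H$ outside $T$ (where $b$ is the first Betti number of $G$), with orientations, and let $\gamma_i$ be the closed walk in $H$ that starts at $\alpha$, goes through $T$ to the origin of $e_i$, traverses $e_i$, and returns through $T$ to $\alpha$; these walks freely generate the fundamental group of $H$. For closed walks $\gamma,\gamma'$ based at $\alpha$, let $s(\gamma,\gamma')$ be the length of the path that they have in common at the start. For a minimal loop $\gamma_0$, the overlap lengths of $\gamma_0$ are the numbers $s_v(\gamma_0^{\pm1},\gamma_i^{\pm1})$, for all choices of signs, $i=1,\dots,b-1$, all $v$ as above and all special spanning trees for $v$. Let $\gamma_0$ be a minimal loop of $G=K+a\omega$. Suppose that its overlap lengths are edge-reconstructible, in the following sense: every graph $K+a\omega'$ with the same edge deck as $G$ is isomorphic to some $K+a\omega''$ that has a minimal loop with the same overlap lengths as $\gamma_0$. Then $G$ is edge-reconstructible. -/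

import Mathlib

universe u

namespace EdgeRecon

open SimpleGraph

/-- Two graphs have the same edge deck: the multisets of isomorphism classes of their
edge-deleted subgraphs coincide. -/
def SameEdgeDeck {V V' : Type*} (G : SimpleGraph V) (G' : SimpleGraph V') : Prop :=
  ∃ f : G.edgeSet ≃ G'.edgeSet, ∀ e : G.edgeSet,
    Nonempty (G.deleteEdges {e.1} ≃g G'.deleteEdges {(f e).1})

/-- `G` is determined up to isomorphism, among finite graphs, by its edge deck. -/
def EdgeReconstructible {V : Type u} (G : SimpleGraph V) : Prop :=
  ∀ (V' : Type u) [Finite V'] (G' : SimpleGraph V'), SameEdgeDeck G G' → Nonempty (G ≃g G')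

open Classical in
/-- The standing assumptions on `G`, with `δ` its minimal degree. -/
structure Standing {V : Type u} [Fintype V] (G : SimpleGraph V) : Prop where
  two_le_minDegree : 2 ≤ G.minDegree
  connected : G.Connected
  no_cut_vertex : ∀ v : V, (G.induce {v}ᶜ).Preconnected
  card_connected : ∀ e ∈ G.edgeSet, (G.deleteEdges {e}).Connected
  card_degree : ∀ e ∈ G.edgeSet,
    {x : V | (G.deleteEdges {e}).degree x + 1 = G.minDegree}.Subsingleton

/-- The card of `G` in which the edge between `a` and `ω` is missing. -/
def card {V : Type u} (G : SimpleGraph V) (a ω : V) : SimpleGraph V :=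
  G.deleteEdges {s(a, ω)}

open Classical in
/-- `aω` is an edge of `G`, and `a` has degree `δ - 1` in the card `G - aω`. -/
def IsMissingEdge {V : Type u} [Fintype V] (G : SimpleGraph V) (a ω : V) : Prop :=
  G.Adj a ω ∧ (card G a ω).degree a + 1 = G.minDegree

open Classical in
/-- The vertices kept in the reduced card: if `a` is pendant in `K`, it is removed. -/
def coreVerts {V : Type u} [Fintype V] (K : SimpleGraph V) (a : V) : Set V :=
  {x | K.degree a = 1 → x ≠ a}

/-- The reduced card `H`: it is `K` if `a` is not pendant in `K`, and `K - a` if it is. -/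
def core {V : Type u} [Fintype V] (K : SimpleGraph V) (a : V) :
    SimpleGraph (coreVerts K a) :=
  K.induce (coreVerts K a)

open Classical in
/-- The base vertex `α` of the reduced card: `a` itself if `a` is not pendant in `K`, and the
unique neighbour of `a` in `K` if it is. -/
def IsBase {V : Type u} [Fintype V] (K : SimpleGraph V) (a : V) (α : coreVerts K a) : Prop :=
  (K.degree a = 1 → K.Adj a α) ∧ (K.degree a ≠ 1 → (α : V) = a)

/-- An embedded closed walk based at `α` that traverses the oriented edge from `a` to `ω`
(exactly once, being a cycle). -/
def IsLoopThrough {V : Type u} {G : SimpleGraph V} (a ω : V) {α : V} (γ : G.Walk α α) : Prop :=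
  γ.IsCycle ∧ ∃ d ∈ γ.darts, d.fst = a ∧ d.snd = ω

/-- An embedded closed walk through the oriented edge from `a` to `ω` of minimal length. -/
def IsMinimalLoop {V : Type u} {G : SimpleGraph V} (a ω : V) {α : V} (γ : G.Walk α α) : Prop :=
  IsLoopThrough a ω γ ∧ ∀ γ' : G.Walk α α, IsLoopThrough a ω γ' → γ.length ≤ γ'.length

open Classical in
/-- The vertices `v` of `H` to which special spanning trees are attached. -/
def IsSpecialVertex {W : Type u} [Fintype W] (H : SimpleGraph W) (α v : W) : Prop :=
  v ≠ α ∧ 3 ≤ H.degree v ∧ (H.Adj v α → 3 ≤ H.degree α)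

/-- `T` is a spanning tree of `H` that avoids an edge `e₁` ending in `α` and an edge `e_v` ending
in `v` whose origin is not `α`. -/
def IsSpecialTree {W : Type u} (H : SimpleGraph W) (α v : W) (T : SimpleGraph W) : Prop :=
  T ≤ H ∧ T.IsTree ∧
    (∃ x, H.Adj x α ∧ ¬ T.Adj x α) ∧ (∃ y, H.Adj y v ∧ ¬ T.Adj y v ∧ y ≠ α)

/-- `γ` is the closed walk in `H` that starts in `α`, goes to the origin of `d` through `T`,
traverses the oriented edge `d`, which is not in `T`, and goes back to `α` through `T`.
If `d` runs through all oriented edges outside `T`, these walks are the generators of the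
fundamental group of `H` given by `T`, together with their inverses. -/
def IsFundamentalLoop {W : Type u} {H : SimpleGraph W} (T : SimpleGraph W) (hT : T ≤ H) {α : W}
    (d : H.Dart) (γ : H.Walk α α) : Prop :=
  ¬ T.Adj d.fst d.snd ∧ ∃ (p : T.Walk α d.fst) (q : T.Walk d.snd α), p.IsPath ∧ q.IsPath ∧
    γ = (p.mapLe hT).append (Walk.cons d.adj (q.mapLe hT))

open Classical in
/-- The length of the longest common initial segment of two lists. -/
noncomputable def commonPrefixLength {β : Type u} : List β → List β → ℕ
  | x :: l, y :: m => if x = y then commonPrefixLength l m + 1 else 0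
  | _, _ => 0

/-- The overlap `s(γ, γ')`: the length of the path that two walks starting at the same vertex
have in common at the start. The walks may live in different graphs on the same vertices. -/
noncomputable def overlap {V : Type u} {G G' : SimpleGraph V} {α : V}
    (γ : G.Walk α α) (γ' : G'.Walk α α) : ℕ :=
  commonPrefixLength γ.edges γ'.edges

open Classical in
/-- `γ₀` (a closed walk in `G`) and `γ₀'` (a closed walk in `G'`), together with their inverses,
have the same overlaps with all the closed walks `γᵢ` and their inverses, in the reduced card of
`K`, that come from special spanning trees. -/
def SameOverlaps {V : Type u} [Fintype V] (K : SimpleGraph V) (a : V) (α : coreVerts K a)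
    {G G' : SimpleGraph V} (γ₀ : G.Walk (α : V) α) (γ₀' : G'.Walk (α : V) α) : Prop :=
  ∀ v, IsSpecialVertex (core K a) α v →
    ∀ (T : SimpleGraph (coreVerts K a)) (hT : T ≤ core K a), IsSpecialTree (core K a) α v T →
    ∀ (d : (core K a).Dart) (γ : (core K a).Walk α α), IsFundamentalLoop T hT d γ →
      let γK : K.Walk (α : V) α := γ.map (Embedding.induce (coreVerts K a)).toHom
      overlap γ₀ γK = overlap γ₀' γK ∧ overlap γ₀.reverse γK = overlap γ₀'.reverse γK

/-- The overlaps of `γ₀` with the closed walks `γᵢ` are edge-reconstructible from the card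
`K = G - aω`: every graph `K + aω'` with the same edge deck as `G` is isomorphic to some
`K + aω''` in which these values, for a suitable minimal closed walk through the edge from
`a` to `ω''`, are the same as in `G`. -/
def OverlapsReconstructible {V : Type u} [Fintype V] (G : SimpleGraph V) (a ω : V)
    (α : coreVerts (card G a ω) a) (γ₀ : G.Walk (α : V) α) : Prop :=
  ∀ ω' : V, SameEdgeDeck G (card G a ω ⊔ edge a ω') →
    ∃ ω'' : V, Nonempty ((card G a ω ⊔ edge a ω') ≃g (card G a ω ⊔ edge a ω'')) ∧
      ∃ γ₀' : (card G a ω ⊔ edge a ω'').Walk (α : V) α,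
        IsMinimalLoop a ω'' γ₀' ∧ SameOverlaps (card G a ω) a α γ₀ γ₀'

end EdgeRecon

/-! A graph with the edge deck of `G` consists of a copy of the card `K` and one more edge. All
graphs with this deck have minimal degree at least `δ` (`Standing.minDegree_le`), so that edge must
end in the vertex `a` of degree `δ - 1`, and the graph is some `K + aω'`
(`Standing.exists_iso_sup_edge`). By hypothesis its overlaps may be taken to agree with those of
`G`. It remains to find an automorphism of the reduced card `H` that fixes `α` and moves `ω` to
`ω'`, because it extends to the completed graphs (`nonempty_iso_of_core_iso`).

The inverse of a minimal loop is a geodesic `P` of `H` from `α` to `ω`, followed by one or two edges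
at `a` outside `H` (`exists_geodesic_of_isMinimalLoop`). If `P` is an initial segment of a loop of a
special tree (`Detected`), equality of overlaps forces the other geodesic `P'` to start with `P`. So
enough special trees are needed. One that contains a given path exists as soon as its two excluded
edges are off the path and their removal leaves `H` connected (`exists_specialTree`).

`Reduced` collects what is known about `H`. The degrees of `ω` and `ω'` agree, since the deck
determines the sum of the squared degrees. Vertices of degree `δ` are not adjacent in `G`, so an
edge of `H` between vertices of degree two other than `α` meets both `ω` and `ω'`. As `G` has no cut
vertex, every component of `H - v` contains `α` or `ω`.

Geodesics to special vertices are detected (`detected_of_special`). If `ω` has degree two, one tries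
to detect `P` together with the unused edge at `ω`, so that `P'` cannot go on after `P`, or `P`
alone if `P'` is no longer than `P` (`eq_of_degree_two_of_three_le`, `exists_iso_of_degree_two`). In
the few remaining configurations an explicit automorphism exchanges `ω` and `ω'`. The cases are put
together in `exists_iso_of_overlapsAgree`. -/

namespace EdgeRecon

open SimpleGraph

/-! ### Bridges, the branches behind them, and spanning trees through a path -/

section Reachability

variable {W : Type*} {G : SimpleGraph W}

lemma mem_of_reachable {S : Set W} (hS : ∀ u ∈ S, ∀ w, G.Adj u w → w ∈ S) {u w : W}
    (h : G.Reachable u w) (hu : u ∈ S) : w ∈ S := by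
  obtain ⟨p⟩ := h
  induction p with
  | nil => exact hu
  | cons h _ ih => exact ih (hS _ hu _ h)

/-- The vertices that can be reached from `c` without the edge between `v` and `c`. -/
def branch (G : SimpleGraph W) (v c : W) : Set W :=
  {u | (G.deleteEdges {s(v, c)}).Reachable c u}

lemma self_mem_branch (v c : W) : c ∈ branch G v c := Reachable.refl _

/-- Only the edge `vc` has been removed, so a branch can be left only by the step from `c` to `v`.
For an edge `vc`, the recurring condition `v ∉ branch G v c` says that it is a bridge. -/
lemma mem_branch_of_adj {v c u w : W} (hu : u ∈ branch G v c) (h : G.Adj u w)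
    (hw : w ≠ v ∨ u ≠ c) : w ∈ branch G v c := by
  by_cases hwc : w = c
  · subst hwc; exact self_mem_branch v w
  · refine Reachable.trans hu (Adj.reachable ?_)
    rw [deleteEdges_adj]
    refine ⟨h, ?_⟩
    simp only [Set.mem_singleton_iff, Sym2.eq_iff]
    tauto

lemma branch_closed_compl {v c u w : W} (hu : u ∉ branch G v c) (h : G.Adj u w)
    (hw : u ≠ v ∨ w ≠ c) : w ∉ branch G v c := by
  intro hwb
  refine hu (mem_branch_of_adj hwb h.symm ?_)
  tauto

lemma branch_induction {v c : W} {S : Set W} (hc : c ∈ S)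
    (hS : ∀ u ∈ branch G v c, u ∈ S → ∀ w, G.Adj u w → s(u, w) ≠ s(v, c) →
      w ∈ branch G v c → w ∈ S) :
    branch G v c ⊆ S := by
  intro u hu
  have := mem_of_reachable (G := G.deleteEdges {s(v, c)}) (S := {u | u ∈ branch G v c ∧ u ∈ S})
    (fun u hu w h => by
      have hw : w ∈ branch G v c := Reachable.trans hu.1 h.reachable
      rw [deleteEdges_adj] at h
      exact ⟨hw, hS u hu.1 hu.2 w h.1 (by simpa using h.2) hw⟩) hu ⟨self_mem_branch v c, hc⟩
  exact this.2

/-- Different bridges at `v` have disjoint branches: a walk inside the second branch never meets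
`v`, and without meeting `v` it cannot enter the first. -/
lemma branch_disjoint {v c c' : W} (hcc : c ≠ c') (h' : G.Adj v c')
    (hv : v ∉ branch G v c) (hv' : v ∉ branch G v c') {u : W}
    (hu' : u ∈ branch G v c') : u ∉ branch G v c := by
  have hc' : c' ∉ branch G v c := fun h =>
    hv (mem_branch_of_adj h h'.symm (Or.inr hcc.symm))
  refine branch_induction (S := {u | u ∉ branch G v c}) hc' (fun u hu hus w h _ _ => ?_) hu'
  exact branch_closed_compl hus h (Or.inl fun h => hv' (h ▸ hu))

lemma connected_deleteEdges_of_mem_branch (hG : G.Connected) {v c : W} (h : v ∈ branch G v c) :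
    (G.deleteEdges {s(v, c)}).Connected := by
  apply hG.connected_delete_edge_of_not_isBridge
  rw [isBridge_iff, not_not]
  exact Reachable.symm h

lemma support_disjoint_branch {v c u w : W} (p : G.Walk u w) (hp : s(v, c) ∉ p.edges)
    (hu : u ∉ branch G v c) : ∀ z ∈ p.support, z ∉ branch G v c := by
  induction p with
  | nil => simpa using hu
  | @cons u u' w h p ih =>
    simp only [Walk.edges_cons, List.mem_cons, not_or, Sym2.eq_iff] at hp
    intro z hz
    rw [Walk.support_cons, List.mem_cons] at hz
    rcases hz with rfl | hz
    · exact hu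
    · refine ih hp.2 (branch_closed_compl hu h ?_) z hz
      have := hp.1
      tauto

lemma notMem_branch_of_walk {v c u : W} (p : G.Walk u v) (hp : s(v, c) ∉ p.edges)
    (hv : v ∉ branch G v c) : u ∉ branch G v c := by
  have := support_disjoint_branch p.reverse (by simpa using hp) hv u (by simp)
  exact this

/-- A walk that enters or leaves a branch runs through the vertex to which it is attached. -/
lemma mem_support_of_mem_branch {v c u w : W} (p : G.Walk u w)
    (hu : u ∉ branch G v c) (hw : w ∈ branch G v c) : v ∈ p.support ∧ c ∈ p.support := by
  by_contra h
  refine support_disjoint_branch p (fun he => h ?_) hu w p.end_mem_support hw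
  exact ⟨p.fst_mem_support_of_mem_edges he, p.snd_mem_support_of_mem_edges he⟩

/-- A finite branch behind a bridge without dead ends contains an edge that is not a bridge. -/
lemma exists_nonbridge_of_branch [Finite W] {v c : W} (h : G.Adj v c) (hv : v ∉ branch G v c)
    (hdeg : ∀ u ∈ branch G v c, ∀ z, ∃ z', z' ≠ z ∧ G.Adj u z') :
    ∃ w ∈ branch G v c, ∃ y ∈ branch G v c, G.Adj w y ∧ w ∈ branch G w y ∧
      ∃ y₁ y₂, y₁ ≠ y₂ ∧ y₁ ≠ y ∧ y₂ ≠ y ∧ G.Adj w y₁ ∧ G.Adj w y₂ := by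
  induction hn : (branch G v c).ncard using Nat.strong_induction_on generalizing v c with
  | _ n ih =>
  have hcv : c ≠ v := h.ne'
  obtain ⟨c', hc'v, hcc'⟩ := hdeg c (self_mem_branch v c) v
  have hc' : c' ∈ branch G v c := mem_branch_of_adj (self_mem_branch v c) hcc' (Or.inl hc'v)
  by_cases hb : c ∈ branch G c c'
  -- Besides `c'`, the vertex `c` has the neighbours `v` and `b`, where `b` comes first on a path to
  -- `c'` that avoids `cc'`. They differ, because a path that leaves `c` through the bridge to `v`
  -- cannot return to the branch.
  · refine ⟨c, self_mem_branch v c, c', hc', hcc', hb, v, ?_⟩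
    have hr : (G.deleteEdges {s(c, c')}).Reachable c c' := Reachable.symm hb
    obtain ⟨p, hp⟩ := hr.exists_isPath
    cases p with
    | nil => exact absurd hcc' (G.loopless.irrefl c)
    | @cons _ b _ hcb q =>
      have hcb' := hcb
      rw [deleteEdges_adj] at hcb
      rw [Walk.cons_isPath_iff] at hp
      refine ⟨b, ?_, hc'v.symm, ?_, h.symm, hcb.1⟩
      · rintro rfl
        have hcq : s(v, c) ∉ (q.mapLe (deleteEdges_le _)).edges := by
          intro he
          exact hp.2 (by simpa using Walk.snd_mem_support_of_mem_edges _ he)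
        exact support_disjoint_branch _ hcq hv c' (Walk.end_mem_support _) hc'
      · rintro rfl
        simp at hcb
  -- Now `cc'` is a bridge as well, and the branch behind it is strictly smaller since it misses
  -- `c`.
  · have hvc : v ∉ branch G c c' := by
      intro hvb
      exact hb (mem_branch_of_adj hvb h (Or.inr hc'v.symm))
    have hsub : branch G c c' ⊆ branch G v c := by
      refine branch_induction (S := branch G v c) hc' (fun u hu hus w huw _ hw => ?_)
      exact mem_branch_of_adj hus huw (Or.inl fun h => hvc (h ▸ hw))
    have hlt : (branch G c c').ncard < n := by
      rw [← hn]
      refine Set.ncard_lt_ncard ⟨hsub, fun h => hb (h (self_mem_branch v c))⟩ (Set.toFinite _)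
    obtain ⟨w, hw, y, hy, h⟩ := ih _ hlt hcc' hb (fun u hu => hdeg u (hsub hu)) rfl
    exact ⟨w, hsub hw, y, hsub hy, h⟩

lemma exists_append_of_mem_support {u w z : W} (p : G.Walk u w) (hz : z ∈ p.support) :
    ∃ (q : G.Walk u z) (r : G.Walk z w), p = q.append r := by
  classical
  exact ⟨p.takeUntil z hz, p.dropUntil z hz, (p.take_spec hz).symm⟩

/-- Each further edge of the path attaches a vertex that was isolated before. -/
lemma isAcyclic_fromEdgeSet_path {u w : W} (p : G.Walk u w) (hp : p.IsPath) :
    (fromEdgeSet {e | e ∈ p.edges}).IsAcyclic := by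
  induction p with
  | nil => simp
  | @cons u v w h p ih =>
    rw [Walk.cons_isPath_iff] at hp
    have : fromEdgeSet {e | e ∈ (Walk.cons h p).edges} =
        fromEdgeSet {e | e ∈ p.edges} ⊔ edge u v := by
      ext a b
      simp only [fromEdgeSet_adj, Walk.edges_cons, List.mem_cons, Set.mem_ofPred_eq, sup_adj,
        edge_adj, Sym2.eq_iff]
      tauto
    rw [this]
    apply (ih hp.1).sup_edge_of_not_reachable
    intro hr
    refine h.ne' (mem_of_reachable (S := {u}) (fun a ha b hab => ?_) hr rfl)
    rw [Set.mem_singleton_iff] at ha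
    subst ha
    rw [fromEdgeSet_adj] at hab
    exact absurd (Walk.fst_mem_support_of_mem_edges _ hab.1) hp.2

lemma exists_isTree_of_path (hG : G.Connected) {u w : W} (p : G.Walk u w) (hp : p.IsPath) :
    ∃ T ≤ G, T.IsTree ∧ ∀ e ∈ p.edges, e ∈ T.edgeSet := by
  obtain ⟨T, h1, h2, hT⟩ := hG.exists_isTree_le_of_le_of_isAcyclic
    (H := fromEdgeSet {e | e ∈ p.edges}) (by
      intro a b h
      rw [fromEdgeSet_adj] at h
      exact p.adj_of_mem_edges h.1) (isAcyclic_fromEdgeSet_path p hp)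
  refine ⟨T, h2, hT, fun e he => ?_⟩
  induction e with | h a b =>
  exact h1 ((fromEdgeSet_adj _).2 ⟨he, (p.adj_of_mem_edges he).ne⟩)

end Reachability
end EdgeRecon

namespace EdgeRecon

open SimpleGraph

/-! ### Common initial segments, walks and neighbours -/

section CommonPrefix

lemma le_commonPrefixLength {β : Type u} {r l m : List β} (hl : r <+: l) (hm : r <+: m) :
    r.length ≤ commonPrefixLength l m := by
  induction r generalizing l m with
  | nil => simp
  | cons a r ih =>
    obtain ⟨l', rfl⟩ := hl
    obtain ⟨m', rfl⟩ := hm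
    simp only [List.cons_append, commonPrefixLength, if_true, List.length_cons]
    exact Nat.succ_le_succ (ih (List.prefix_append _ _) (List.prefix_append _ _))

lemma prefix_of_le_commonPrefixLength {β : Type u} {r l m : List β} (hm : r <+: m)
    (h : r.length ≤ commonPrefixLength l m) : r <+: l := by
  induction r generalizing l m with
  | nil => simp
  | cons a r ih =>
    obtain ⟨m', rfl⟩ := hm
    cases l with
    | nil => simp [commonPrefixLength] at h
    | cons b l =>
      simp only [List.cons_append, commonPrefixLength, List.length_cons] at h
      split_ifs at h with hb
      · subst hb
        rw [List.cons_prefix_cons]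
        exact ⟨rfl, ih (List.prefix_append _ _) (Nat.le_of_succ_le_succ h)⟩
      · omega

/-- The comparison stops at the first entry of `t` at the latest. This removes the edges outside the
reduced card at the end of an inverse loop. -/
lemma commonPrefixLength_append_of_notMem {β : Type u} {l t m : List β}
    (h : ∀ e ∈ t, e ∉ m) : commonPrefixLength (l ++ t) m = commonPrefixLength l m := by
  induction l generalizing m with
  | nil =>
    cases t with
    | nil => rfl
    | cons a t =>
      cases m with
      | nil => simp [commonPrefixLength]
      | cons b m =>
        have : a ≠ b := fun hab => h a (by simp) (by simp [hab])
        simp [commonPrefixLength, this]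
  | cons a l ih =>
    cases m with
    | nil => simp [commonPrefixLength]
    | cons b m =>
      simp only [List.cons_append, commonPrefixLength]
      rw [ih fun e he hem => h e he (List.mem_cons_of_mem _ hem)]

lemma commonPrefixLength_map {β γ : Type u} {f : β → γ} (hf : Function.Injective f)
    (l m : List β) : commonPrefixLength (l.map f) (m.map f) = commonPrefixLength l m := by
  induction l generalizing m with
  | nil => cases m <;> simp [commonPrefixLength]
  | cons a l ih =>
    cases m with
    | nil => simp [commonPrefixLength]
    | cons b m =>
      simp only [List.map_cons, commonPrefixLength, ih]
      by_cases h : a = b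
      · simp [h]
      · simp [h, hf.ne h]

end CommonPrefix

section Walks

variable {W : Type*} {G : SimpleGraph W}

/-- A walk in a simple graph is determined by its start and its edges, so overlaps, which are
measured on edges, give information about walks. -/
lemma exists_append_of_edges {u v w : W} (r : G.Walk u v) (p : G.Walk u w)
    (h : r.edges <+: p.edges) : ∃ s, p = r.append s := by
  induction r with
  | nil => exact ⟨p, rfl⟩
  | @cons u b v hb r ih =>
    cases p with
    | nil => simp at h
    | @cons _ c _ hc p =>
      rw [Walk.edges_cons, Walk.edges_cons, List.cons_prefix_cons] at h
      obtain ⟨h1, h2⟩ := h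
      have hbc : b = c := by
        simp only [Sym2.eq_iff] at h1
        have := hb.ne
        grind
      subst hbc
      obtain ⟨s, rfl⟩ := ih p h2
      exact ⟨s, rfl⟩

lemma Walk.IsPath.eq_of_start_edges {u w x y : W} {p : G.Walk u w} (hp : p.IsPath)
    (hx : s(u, x) ∈ p.edges) (hy : s(u, y) ∈ p.edges) : x = y := by
  cases p with
  | nil => simp at hx
  | @cons _ b _ h p =>
    rw [Walk.cons_isPath_iff] at hp
    have key : ∀ z, s(u, z) ∈ (Walk.cons h p).edges → z = b := by
      intro z hz
      rw [Walk.edges_cons, List.mem_cons] at hz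
      rcases hz with hz | hz
      · have := h.ne
        simp only [Sym2.eq_iff] at hz
        grind
      · exact absurd (Walk.fst_mem_support_of_mem_edges _ hz) hp.2
    rw [key x hx, key y hy]

lemma Walk.IsPath.eq_of_end_edges {u w x y : W} {p : G.Walk u w} (hp : p.IsPath)
    (hx : s(w, x) ∈ p.edges) (hy : s(w, y) ∈ p.edges) : x = y :=
  Walk.IsPath.eq_of_start_edges hp.reverse (by simpa using hx) (by simpa using hy)

lemma exists_eq_concat {u w : W} (p : G.Walk u w) (h : u ≠ w) :
    ∃ (y : W) (q : G.Walk u y) (hy : G.Adj y w), p = q.concat hy := by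
  cases p with
  | nil => exact absurd rfl h
  | cons h p => exact ⟨_, _, _, (Walk.exists_cons_eq_concat h p).choose_spec.choose_spec.choose_spec⟩

lemma exists_eq_cons {u w : W} (p : G.Walk u w) (h : u ≠ w) :
    ∃ (y : W) (hy : G.Adj u y) (q : G.Walk y w), p = Walk.cons hy q := by
  cases p with
  | nil => exact absurd rfl h
  | cons h p => exact ⟨_, _, _, rfl⟩

/-- A neighbour of the end of a geodesic that lies on it is the last vertex before the end. -/
lemma mem_edges_of_geodesic {u w y : W} {p : G.Walk u w} (hp : p.length = G.dist u w)
    (hy : G.Adj y w) (hmem : y ∈ p.support) : s(y, w) ∈ p.edges := by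
  obtain ⟨q, r, rfl⟩ := exists_append_of_mem_support p hmem
  have h1 : G.dist u w ≤ (q.concat hy).length := dist_le _
  rw [← hp, Walk.length_append, Walk.length_concat] at h1
  cases r with
  | nil => exact absurd hy (G.loopless.irrefl _)
  | @cons _ b _ h r =>
    rw [Walk.length_cons] at h1
    have : r.length = 0 := by omega
    have hb := Walk.eq_of_length_eq_zero this
    subst hb
    simp

end Walks

open Classical

section Neighbours

variable {W : Type*} [Fintype W] {H : SimpleGraph W}

lemma exists_adj_ne {u : W} (h : 2 ≤ H.degree u) (z : W) : ∃ z', z' ≠ z ∧ H.Adj u z' := by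
  rw [← card_neighborFinset_eq_degree] at h
  obtain ⟨z', h1, h2⟩ := Finset.exists_mem_ne (s := H.neighborFinset u) (by omega) z
  exact ⟨z', h2, by simpa using h1⟩

lemma exists_adj_ne_ne {u : W} (h : 3 ≤ H.degree u) (z₁ z₂ : W) :
    ∃ z', z' ≠ z₁ ∧ z' ≠ z₂ ∧ H.Adj u z' := by
  rw [← card_neighborFinset_eq_degree] at h
  have : 0 < ((H.neighborFinset u).erase z₁ |>.erase z₂).card := by
    have h1 := Finset.pred_card_le_card_erase (s := H.neighborFinset u) (a := z₁)
    have h2 := Finset.pred_card_le_card_erase (s := (H.neighborFinset u).erase z₁) (a := z₂)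
    omega
  obtain ⟨z', hz⟩ := Finset.card_pos.1 this
  simp only [Finset.mem_erase, mem_neighborFinset] at hz
  exact ⟨z', hz.2.1, hz.1, hz.2.2⟩

lemma three_le_degree {u a b c : W} (ha : H.Adj u a) (hb : H.Adj u b) (hc : H.Adj u c)
    (hab : a ≠ b) (hac : a ≠ c) (hbc : b ≠ c) : 3 ≤ H.degree u := by
  rw [← card_neighborFinset_eq_degree]
  have : ({a, b, c} : Finset W).card = 3 := Finset.card_eq_three.2 ⟨a, b, c, hab, hac, hbc, rfl⟩
  rw [← this]
  apply Finset.card_le_card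
  intro z
  simp only [Finset.mem_insert, Finset.mem_singleton, mem_neighborFinset]
  rintro (rfl | rfl | rfl) <;> assumption

lemma eq_or_eq_of_degree_eq_two {u a b c : W} (h : H.degree u = 2) (ha : H.Adj u a)
    (hb : H.Adj u b) (hab : a ≠ b) (hc : H.Adj u c) : c = a ∨ c = b := by
  by_contra hn
  push Not at hn
  have := three_le_degree ha hb hc hab hn.1.symm hn.2.symm
  omega

end Neighbours

/-! ### Detecting an initial segment by a special spanning tree -/

section Detection

variable {W : Type u} {H : SimpleGraph W} {α : W}

/-- The path `R` survives the removal of `e₁ = αx` and `e_v = vy`, and it is extended to a spanning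
tree of the remaining connected graph. -/
lemma exists_specialTree {v x y t : W} (hx : H.Adj α x) (hy : H.Adj v y) (hyα : y ≠ α)
    (hc : ((H.deleteEdges {s(α, x)}).deleteEdges {s(v, y)}).Connected) (R : H.Walk α t)
    (hR : R.IsPath) (h1 : s(α, x) ∉ R.edges) (h2 : s(v, y) ∉ R.edges) :
    ∃ T ≤ H, IsSpecialTree H α v T ∧ T ≤ H.deleteEdges {s(α, x)} ∧ ¬ T.Adj α x ∧ ¬ T.Adj v y ∧
      ∃ q : T.Walk α t, q.IsPath ∧ q.edges = R.edges := by
  have hR' : ∀ e ∈ R.edges,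
      e ∈ ((H.deleteEdges {s(α, x)}).deleteEdges {s(v, y)}).edgeSet := by
    intro e he
    simp only [edgeSet_deleteEdges, Set.mem_sdiff, Set.mem_singleton_iff]
    exact ⟨⟨R.edges_subset_edgeSet he, fun h => h1 (h ▸ he)⟩, fun h => h2 (h ▸ he)⟩
  obtain ⟨T, hT, hTt, hTR⟩ := exists_isTree_of_path hc (R.transfer _ hR') (hR.transfer hR')
  rw [Walk.edges_transfer] at hTR
  have hle : T ≤ H.deleteEdges {s(α, x)} := hT.trans (deleteEdges_le _)
  have hTx : ¬ T.Adj α x := fun h => by simpa using hle h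
  have hTy : ¬ T.Adj v y := fun h => by simpa using hT h
  refine ⟨T, hle.trans (deleteEdges_le _), ⟨hle.trans (deleteEdges_le _), hTt,
    ⟨x, hx.symm, fun h => hTx h.symm⟩, ⟨y, hy.symm, fun h => hTy h.symm, hyα⟩⟩, hle, hTx, hTy,
    R.transfer T hTR, hR.transfer hTR, R.edges_transfer hTR⟩

variable [Fintype W]

/-- The list of edges `l` is an initial segment of a closed walk that comes from a special
spanning tree. -/
def Detected (H : SimpleGraph W) (α : W) (l : List (Sym2 W)) : Prop :=
  ∃ v, IsSpecialVertex H α v ∧ ∃ (T : SimpleGraph W) (hT : T ≤ H), IsSpecialTree H α v T ∧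
    ∃ (d : H.Dart) (γ : H.Walk α α), IsFundamentalLoop T hT d γ ∧ l <+: γ.edges

/-- The lists of edges `l` and `l'` have the same overlaps with all the closed walks that come
from special spanning trees. -/
def OverlapsAgree (H : SimpleGraph W) (α : W) (l l' : List (Sym2 W)) : Prop :=
  ∀ v, IsSpecialVertex H α v → ∀ (T : SimpleGraph W) (hT : T ≤ H), IsSpecialTree H α v T →
    ∀ (d : H.Dart) (γ : H.Walk α α), IsFundamentalLoop T hT d γ →
      commonPrefixLength l γ.edges = commonPrefixLength l' γ.edges

lemma OverlapsAgree.symm {l l' : List (Sym2 W)} (h : OverlapsAgree H α l l') :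
    OverlapsAgree H α l' l :=
  fun v hv T hT hs d γ hγ => (h v hv T hT hs d γ hγ).symm

/-- The overlap with a loop that starts with `r` reveals whether a list starts with `r`. -/
lemma OverlapsAgree.transfer {l l' r : List (Sym2 W)} (h : OverlapsAgree H α l l')
    (hr : Detected H α r) (hl : r <+: l) : r <+: l' := by
  obtain ⟨v, hv, T, hT, hs, d, γ, hγ, hrγ⟩ := hr
  have := le_commonPrefixLength hl hrγ
  rw [h v hv T hT hs d γ hγ] at this
  exact prefix_of_le_commonPrefixLength hrγ this

lemma Detected.mono {r l : List (Sym2 W)} (h : Detected H α l) (hr : r <+: l) :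
    Detected H α r := by
  obtain ⟨v, hv, T, hT, hs, d, γ, hγ, hrγ⟩ := h
  exact ⟨v, hv, T, hT, hs, d, γ, hγ, hr.trans hrγ⟩

/-- A path followed by an edge at its end is detected if the edge can serve as the edge outside
the tree that ends in the special vertex. -/
lemma detected_concat {v x y t t' : W} (hv : IsSpecialVertex H α v) (hx : H.Adj α x)
    (hy : H.Adj v y) (hyα : y ≠ α)
    (hc : ((H.deleteEdges {s(α, x)}).deleteEdges {s(v, y)}).Connected) (R : H.Walk α t)
    (hR : R.IsPath) (h1 : s(α, x) ∉ R.edges) (h2 : s(v, y) ∉ R.edges)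
    (he : s(t, t') = s(v, y)) : Detected H α (R.edges ++ [s(t, t')]) := by
  obtain ⟨T, hT, hs, -, -, hTy, q, hq, hqR⟩ := exists_specialTree hx hy hyα hc R hR h1 h2
  have htt : H.Adj t t' := by rw [← mem_edgeSet, he]; exact hy
  have hTt : ¬ T.Adj t t' := by rw [← mem_edgeSet, he]; exact hTy
  obtain ⟨p, hp⟩ := hs.2.1.connected.exists_isPath t' α
  -- The loop belongs to `e_v` itself, oriented from `t` to `t'`, so its way out through the tree is
  -- `R`.
  refine ⟨v, hv, T, hT, hs, ⟨(t, t'), htt⟩, _, ⟨hTt, q, p, hq, hp, rfl⟩, ?_⟩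
  simp [Walk.edges_append, hqR]

/-- The loop of `e₁`, oriented from `x` to `α`, runs through the tree from `α` to `x` and then
closes up; the tree avoids `αx`. -/
lemma detected_of_forall_path {v x y : W} (hv : IsSpecialVertex H α v) (hx : H.Adj α x)
    (hy : H.Adj v y) (hyα : y ≠ α)
    (hc : ((H.deleteEdges {s(α, x)}).deleteEdges {s(v, y)}).Connected) {l : List (Sym2 W)}
    (h : ∀ p : (H.deleteEdges {s(α, x)}).Walk α x, p.IsPath → l <+: p.edges) :
    Detected H α l := by
  obtain ⟨T, hT, hs, hle, hTx, -⟩ := exists_specialTree hx hy hyα hc Walk.nil Walk.IsPath.nil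
    (by simp) (by simp)
  obtain ⟨p, hp⟩ := hs.2.1.connected.exists_isPath α x
  refine ⟨v, hv, T, hT, hs, ⟨(x, α), hx.symm⟩, _,
    ⟨fun h => hTx h.symm, p, Walk.nil, hp, Walk.IsPath.nil, rfl⟩, ?_⟩
  have := h (p.mapLe hle) (hp.mapLe hle)
  rw [Walk.edges_append]
  exact List.IsPrefix.trans (by simpa using this) (List.prefix_append _ _)

/-- A path is detected if, without the edge between `α` and `x`, all walks from `α` to `x` run
through its end. -/
lemma detected_of_separates {v x y t : W} (hv : IsSpecialVertex H α v) (hx : H.Adj α x)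
    (hy : H.Adj v y) (hyα : y ≠ α)
    (hc : ((H.deleteEdges {s(α, x)}).deleteEdges {s(v, y)}).Connected) (R : H.Walk α t)
    (hR : R.IsPath) (h1 : s(α, x) ∉ R.edges) (h2 : s(v, y) ∉ R.edges)
    (h : ∀ p : (H.deleteEdges {s(α, x)}).Walk α x, t ∈ p.support) :
    Detected H α R.edges := by
  obtain ⟨T, hT, hs, hle, hTx, -, q, hq, hqR⟩ := exists_specialTree hx hy hyα hc R hR h1 h2
  obtain ⟨p, hp⟩ := hs.2.1.connected.exists_isPath α x
  have ht : t ∈ p.support := by simpa using h (p.mapLe hle)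
  obtain ⟨p₁, p₂, rfl⟩ := exists_append_of_mem_support p ht
  -- Paths in a tree are unique, so the tree path to `x` through `t` starts with `R`.
  have hpq : p₁ = q :=
    congrArg Subtype.val ((hs.2.1.isAcyclic.subsingleton_path α t).elim
      ⟨p₁, hp.of_append_left⟩ ⟨q, hq⟩)
  subst hpq
  refine ⟨v, hv, T, hT, hs, ⟨(x, α), hx.symm⟩, _,
    ⟨fun h => hTx h.symm, p₁.append p₂, Walk.nil, hp, Walk.IsPath.nil, rfl⟩, ?_⟩
  simp [Walk.edges_append, hqR]

end Detection
end EdgeRecon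

/-! ### The reduced card and its special vertices -/

namespace EdgeRecon

open SimpleGraph Classical

variable {W : Type u} {H : SimpleGraph W} {α ω ω' : W}

lemma reachable_deleteIncidenceSet_ne {G : SimpleGraph W} {v u w : W} (hu : u ≠ v)
    (h : (G.deleteIncidenceSet v).Reachable u w) : w ≠ v :=
  mem_of_reachable (S := {z | z ≠ v}) (fun _ _ _ hab => (deleteIncidenceSet_adj.1 hab).2.2) h hu

lemma deleteIncidenceSet_mono_deleteEdges (G : SimpleGraph W) (v c : W) :
    G.deleteIncidenceSet v ≤ G.deleteEdges {s(v, c)} := by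
  intro a b h
  rw [deleteIncidenceSet_adj] at h
  rw [deleteEdges_adj]
  refine ⟨h.1, ?_⟩
  simp only [Set.mem_singleton_iff, Sym2.eq_iff]
  tauto

lemma deleteEdges_base_adj {x u w : W} (hu : u ≠ α) (hux : u ≠ x) :
    (H.deleteEdges {s(α, x)}).Adj u w ↔ H.Adj u w := by
  rw [deleteEdges_adj]
  simp only [Set.mem_singleton_iff, Sym2.eq_iff, and_iff_left_iff_imp]
  tauto

lemma deleteEdges_singleton_adj {a b u w : W} (h : H.Adj u w) (hne : s(u, w) ≠ s(a, b)) :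
    (H.deleteEdges {s(a, b)}).Adj u w := by
  rw [deleteEdges_adj]
  exact ⟨h, by simpa using hne⟩

lemma base_mem_branch {x x' v c : W} (hx' : H.Adj α x') (hxx : x' ≠ x) (hv : v ≠ α)
    (h : x' ∈ branch (H.deleteEdges {s(α, x)}) v c) :
    α ∈ branch (H.deleteEdges {s(α, x)}) v c :=
  mem_branch_of_adj h ((deleteEdges_base_adj hx'.ne' hxx).2 hx'.symm) (Or.inl hv.symm)

variable [Fintype W]

/-- What is known about the reduced card `H` with base vertex `α`, if the missing edge leads to
`ω` in one graph and to `ω'` in another one with the same edge deck. -/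
structure Reduced (H : SimpleGraph W) (α ω ω' : W) : Prop where
  connected : H.Connected
  two_le : ∀ u, 2 ≤ H.degree u
  ne : ω ≠ α
  ne' : ω' ≠ α
  degree_eq : H.degree ω' = H.degree ω
  adj_two : ∀ u w, H.Adj u w → u ≠ α → w ≠ α → H.degree u = 2 → H.degree w = 2 →
    (u = ω ∨ w = ω) ∧ (u = ω' ∨ w = ω')
  conn : ∀ v u, u ≠ v →
    (H.deleteIncidenceSet v).Reachable u α ∨ (H.deleteIncidenceSet v).Reachable u ω

namespace Reduced

/-- By `conn` at `v = α`, all components of `H - α` contain `ω`, so `H - α` is connected. The vertex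
`α` stays attached to it through a second neighbour. -/
lemma connected_deleteEdges (R : Reduced H α ω ω') (x : W) : (H.deleteEdges {s(α, x)}).Connected := by
  have key : ∀ u, u ≠ α → (H.deleteEdges {s(α, x)}).Reachable u ω := by
    intro u hu
    rcases R.conn α u hu with h | h
    · exact absurd rfl (reachable_deleteIncidenceSet_ne hu h)
    · exact h.mono (deleteIncidenceSet_mono_deleteEdges H α x)
  obtain ⟨z, hzx, hz⟩ := exists_adj_ne (R.two_le α) x
  have hα : (H.deleteEdges {s(α, x)}).Reachable α ω := by
    refine Reachable.trans (Adj.reachable (v := z) ?_) (key z hz.ne')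
    rw [deleteEdges_adj]
    refine ⟨hz, ?_⟩
    have := hz.ne
    simp only [Set.mem_singleton_iff, Sym2.eq_iff]
    tauto
  have key' : ∀ u, (H.deleteEdges {s(α, x)}).Reachable u ω := fun u =>
    if hu : u = α then hu ▸ hα else key u hu
  rw [connected_iff_exists_forall_reachable]
  exact ⟨ω, fun u => (key' u).symm⟩

end Reduced

/-- A branch that contains neither `α` nor `x` contains a special vertex with an edge in the
branch that is not a bridge. -/
lemma exists_special_of_branch {x v c : W} (hdeg : ∀ u, 2 ≤ H.degree u)
    (hsp : ∀ w, H.Adj w α → w ≠ x → w ∈ branch (H.deleteEdges {s(α, x)}) v c → 3 ≤ H.degree α)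
    (h : (H.deleteEdges {s(α, x)}).Adj v c)
    (hv : v ∉ branch (H.deleteEdges {s(α, x)}) v c)
    (hα : α ∉ branch (H.deleteEdges {s(α, x)}) v c)
    (hx : x ∉ branch (H.deleteEdges {s(α, x)}) v c) :
    ∃ w ∈ branch (H.deleteEdges {s(α, x)}) v c, ∃ y ∈ branch (H.deleteEdges {s(α, x)}) v c,
      IsSpecialVertex H α w ∧ (H.deleteEdges {s(α, x)}).Adj w y ∧
        w ∈ branch (H.deleteEdges {s(α, x)}) w y := by
  have hne : ∀ u ∈ branch (H.deleteEdges {s(α, x)}) v c, u ≠ α ∧ u ≠ x :=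
    fun u hu => ⟨fun h => hα (h ▸ hu), fun h => hx (h ▸ hu)⟩
  obtain ⟨w, hw, y, hy, hwy, hb, y₁, y₂, h12, h1, h2, hw1, hw2⟩ :=
    -- Away from `α` and `x` the removal of `αx` changes no degrees, so the branch has no dead ends.
    exists_nonbridge_of_branch h hv fun u hu z => by
      obtain ⟨z', hz', huz'⟩ := exists_adj_ne (hdeg u) z
      exact ⟨z', hz', (deleteEdges_base_adj (hne u hu).1 (hne u hu).2).2 huz'⟩
  have hle := deleteEdges_le (G := H) {s(α, x)}
  exact ⟨w, hw, y, hy, ⟨(hne w hw).1, three_le_degree (hle hwy) (hle hw1) (hle hw2) h1.symm h2.symm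
    h12, fun h => hsp w h (hne w hw).2 hw⟩, hwy, hb⟩

lemma degree_lt_three {x x' : W} (hα : ∀ z, H.Adj α z → z = x ∨ z = x') : H.degree α < 3 := by
  by_contra h
  obtain ⟨z, h1, h2, hz⟩ := exists_adj_ne_ne (not_lt.1 h) x x'
  exact (hα z hz).elim h1 h2

lemma IsSpecialVertex.not_adj {v : W} (hv : IsSpecialVertex H α v) (h : H.degree α < 3) :
    ¬ H.Adj v α := fun ha => absurd (hv.2.2 ha) (not_le.2 h)

/-- If some vertex is special, and `α` has only the neighbours `x` and `x'`, then there is a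
special vertex with an edge outside a given path that is not a bridge after removal of `αx`. -/
lemma exists_special_edge_of_degree_two {x x' v t : W} (R : Reduced H α ω ω')
    (hx : H.Adj α x) (hα : ∀ z, H.Adj α z → z = x ∨ z = x')
    (hv : IsSpecialVertex H α v) (P : (H.deleteEdges {s(α, x)}).Walk α t) (hP : P.IsPath)
    (hsep : v ∈ P.support → ∀ c, H.Adj v c → s(v, c) ∉ P.edges →
      α ∉ branch (H.deleteEdges {s(α, x)}) v c → v ∉ branch (H.deleteEdges {s(α, x)}) v c →
      x ∉ branch (H.deleteEdges {s(α, x)}) v c) :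
    ∃ w y, IsSpecialVertex H α w ∧ H.Adj w y ∧ s(w, y) ∉ P.edges ∧ y ≠ α ∧
      ((H.deleteEdges {s(α, x)}).deleteEdges {s(w, y)}).Connected := by
  have hd := degree_lt_three hα
  have hva := hv.not_adj hd
  have hvx : v ≠ x := fun h => hva (h ▸ hx.symm)
  have hle := deleteEdges_le (G := H) {s(α, x)}
  have hG := R.connected_deleteEdges x
  have hadj : ∀ c, (H.deleteEdges {s(α, x)}).Adj v c ↔ H.Adj v c :=
    fun c => deleteEdges_base_adj hv.1 hvx
  by_contra hno
  have hbr : ∀ c, H.Adj v c → s(v, c) ∉ P.edges → v ∉ branch (H.deleteEdges {s(α, x)}) v c := by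
    intro c hc hcP hb
    exact hno ⟨v, c, hv, hc, hcP, fun h => hva (h ▸ hc), connected_deleteEdges_of_mem_branch hG hb⟩
  -- By the assumption `hno`, all edges at `v` off `P` are bridges. A branch that contained neither
  -- `α` nor `x` would contain a suitable special vertex.
  have hmem : ∀ c, H.Adj v c → s(v, c) ∉ P.edges → α ∉ branch (H.deleteEdges {s(α, x)}) v c →
      x ∈ branch (H.deleteEdges {s(α, x)}) v c := by
    intro c hc hcP hαb
    by_contra hxb
    obtain ⟨w, hw, y, hy, hws, hwy, hwb⟩ := exists_special_of_branch R.two_le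
      (fun w hwα hwx hw => absurd (base_mem_branch (hwα.symm) hwx hv.1 hw) hαb)
      ((hadj c).2 hc) (hbr c hc hcP) hαb hxb
    refine hno ⟨w, y, hws, hle hwy, fun he => ?_, fun h => hαb (h ▸ hy),
      connected_deleteEdges_of_mem_branch hG hwb⟩
    exact support_disjoint_branch P hcP hαb w (P.fst_mem_support_of_mem_edges he) hw
  obtain ⟨c₁, -, h1⟩ := exists_adj_ne (R.two_le v) v
  obtain ⟨c₂, h21, h2⟩ := exists_adj_ne (R.two_le v) c₁
  obtain ⟨c₃, h31, h32, h3⟩ := exists_adj_ne_ne hv.2.1 c₁ c₂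
  have hdis : ∀ c c', c ≠ c' → H.Adj v c → H.Adj v c' → s(v, c) ∉ P.edges → s(v, c') ∉ P.edges →
      ∀ u, u ∈ branch (H.deleteEdges {s(α, x)}) v c →
        u ∉ branch (H.deleteEdges {s(α, x)}) v c' := by
    intro c c' hcc hc hc' hcP hcP' u hu
    exact branch_disjoint hcc.symm ((hadj c).2 hc) (hbr c' hc' hcP') (hbr c hc hcP) hu
  -- If `P` runs through `v`, it uses at most two edges there; the branch of a third one misses `α`,
  -- so it contains `x`, contrary to `hsep`. If not, three disjoint branches would each contain `α`
  -- or `x`.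
  by_cases hvP : v ∈ P.support
  · obtain ⟨A, B, rfl⟩ := exists_append_of_mem_support P hvP
    have hA : ∀ c c', s(v, c) ∈ A.edges → s(v, c') ∈ A.edges → c = c' :=
      fun c c' h h' => Walk.IsPath.eq_of_end_edges hP.of_append_left h h'
    have hB : ∀ c c', s(v, c) ∈ B.edges → s(v, c') ∈ B.edges → c = c' :=
      fun c c' h h' => Walk.IsPath.eq_of_start_edges hP.of_append_right h h'
    obtain ⟨c, hc, hcP⟩ : ∃ c, H.Adj v c ∧ s(v, c) ∉ (A.append B).edges := by
      by_contra hcon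
      push Not at hcon
      have e1 := hcon c₁ h1
      have e2 := hcon c₂ h2
      have e3 := hcon c₃ h3
      rw [Walk.edges_append, List.mem_append] at e1 e2 e3
      have := hA c₁ c₂; have := hA c₁ c₃; have := hA c₂ c₃
      have := hB c₁ c₂; have := hB c₁ c₃; have := hB c₂ c₃
      grind
    have hαb := notMem_branch_of_walk A (fun h => hcP (by rw [Walk.edges_append]; simp [h]))
      (hbr c hc hcP)
    exact hsep hvP c hc hcP hαb (hbr c hc hcP) (hmem c hc hcP hαb)
  · have hoff : ∀ c, s(v, c) ∉ P.edges := fun c h => hvP (P.fst_mem_support_of_mem_edges h)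
    have d12 := hdis c₂ c₁ h21 h2 h1 (hoff _) (hoff _)
    have d13 := hdis c₃ c₁ h31 h3 h1 (hoff _) (hoff _)
    have d23 := hdis c₃ c₂ h32 h3 h2 (hoff _) (hoff _)
    have m1 := hmem c₁ h1 (hoff _)
    have m2 := hmem c₂ h2 (hoff _)
    have m3 := hmem c₃ h3 (hoff _)
    by_cases hα1 : α ∈ branch (H.deleteEdges {s(α, x)}) v c₁
    · exact d23 x (m3 fun h => d13 α h hα1) (m2 fun h => d12 α h hα1)
    · have hx1 := m1 hα1
      exact d23 α (not_not.1 fun h => d13 x (m3 h) hx1) (not_not.1 fun h => d12 x (m2 h) hx1)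

/-- A branch at `v` that contains neither `α` nor the other end of the edge at `α` contains `ω`. -/
lemma mem_branch_of_conn {x v c : W} (R : Reduced H α ω ω') (hvc : c ≠ v)
    (hα : α ∉ branch (H.deleteEdges {s(α, x)}) v c)
    (hx : x ∉ branch (H.deleteEdges {s(α, x)}) v c) :
    ω ∈ branch (H.deleteEdges {s(α, x)}) v c := by
  have hcl : ∀ u ∈ branch (H.deleteEdges {s(α, x)}) v c, ∀ w, (H.deleteIncidenceSet v).Adj u w →
      w ∈ branch (H.deleteEdges {s(α, x)}) v c := by
    intro u hu w h
    rw [deleteIncidenceSet_adj] at h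
    have huα : u ≠ α := fun h => hα (h ▸ hu)
    have hux : u ≠ x := fun h => hx (h ▸ hu)
    exact mem_branch_of_adj hu ((deleteEdges_base_adj huα hux).2 h.1) (Or.inl h.2.2)
  rcases R.conn v c hvc with h | h
  · exact absurd (mem_of_reachable hcl h (self_mem_branch v c)) hα
  · exact mem_of_reachable hcl h (self_mem_branch v c)

/-- Geodesics to special vertices are detected. -/
lemma detected_of_special {t : W} (R : Reduced H α ω ω') (ht : IsSpecialVertex H α t)
    (P : H.Walk α t) (hP : P.IsPath) (hadj : H.Adj t α → P.length = 1) :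
    Detected H α P.edges := by
  obtain ⟨x', hx', P', rfl⟩ := exists_eq_cons P ht.1.symm
  set P := Walk.cons hx' P' with hPdef
  have hx'P : s(α, x') ∈ P.edges := by simp [P]
  have hoff : ∀ x, x ≠ x' → s(α, x) ∉ P.edges :=
    fun x hx h => hx (Walk.IsPath.eq_of_start_edges hP h hx'P)
  obtain ⟨x, hxx, hx⟩ := exists_adj_ne (R.two_le α) x'
  have hone : H.Adj t α → s(t, α) ∈ P.edges := by
    intro h
    have hlen := hadj h
    rw [hPdef, Walk.length_cons] at hlen
    have := Walk.eq_of_length_eq_zero (p := P') (by omega)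
    subst this
    rw [Sym2.eq_swap]
    exact hx'P
  have hxt : ∀ x, H.Adj α x → x ≠ x' → t ≠ x := by
    rintro x hx hxx rfl
    have := hone hx.symm
    rw [Sym2.eq_swap] at this
    exact hoff _ hxx this
  have hend : ∀ c, s(t, c) ∉ P.edges → H.Adj t c → c ≠ α := by
    rintro c hc htc rfl
    exact hc (hone htc)
  have hdet : ∀ x c, H.Adj α x → x ≠ x' → H.Adj t c → s(t, c) ∉ P.edges →
      t ∈ branch (H.deleteEdges {s(α, x)}) t c → Detected H α P.edges := by
    intro x c hx hxx hc hcP hb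
    exact (detected_concat ht hx hc (hend c hcP hc)
      (connected_deleteEdges_of_mem_branch (R.connected_deleteEdges x) hb) P hP (hoff x hxx) hcP
      rfl).mono (List.prefix_append _ _)
  -- If `P` is not detected, all edges at `t` off `P` are bridges of `H - αx`, and by `conn` each
  -- branch behind them contains `x` or `ω`. There are at least two such edges and their branches
  -- are disjoint, so one branch contains `x` and another does not.
  by_contra hno
  have hle := deleteEdges_le (G := H) {s(α, x)}
  have hG := R.connected_deleteEdges x
  have hPe : ∀ e ∈ P.edges, e ∈ (H.deleteEdges {s(α, x)}).edgeSet := by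
    intro e he
    rw [edgeSet_deleteEdges]
    exact ⟨P.edges_subset_edgeSet he, fun h => hoff x hxx (h ▸ he)⟩
  have hbr : ∀ c, H.Adj t c → s(t, c) ∉ P.edges →
      t ∉ branch (H.deleteEdges {s(α, x)}) t c :=
    fun c hc hcP hb => hno (hdet x c hx hxx hc hcP hb)
  have hαb : ∀ c, H.Adj t c → s(t, c) ∉ P.edges →
      α ∉ branch (H.deleteEdges {s(α, x)}) t c :=
    fun c hc hcP => notMem_branch_of_walk (P.transfer _ hPe) (by simpa using hcP) (hbr c hc hcP)
  have hω : ∀ c, H.Adj t c → s(t, c) ∉ P.edges →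
      x ∈ branch (H.deleteEdges {s(α, x)}) t c ∨ ω ∈ branch (H.deleteEdges {s(α, x)}) t c := by
    intro c hc hcP
    by_contra h
    push Not at h
    exact h.2 (mem_branch_of_conn R hc.ne' (hαb c hc hcP) h.1)
  have hedge : ∀ c c', s(t, c) ∈ P.edges → s(t, c') ∈ P.edges → c = c' :=
    fun c c' h h' => Walk.IsPath.eq_of_end_edges hP h h'
  have hdis : ∀ c c', c ≠ c' → H.Adj t c → H.Adj t c' → s(t, c) ∉ P.edges → s(t, c') ∉ P.edges →
      ∀ u, u ∈ branch (H.deleteEdges {s(α, x)}) t c →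
        u ∉ branch (H.deleteEdges {s(α, x)}) t c' := by
    intro c c' hcc hc hc' hcP hcP' u hu
    exact branch_disjoint hcc.symm ((deleteEdges_base_adj ht.1 (hxt x hx hxx)).2 hc)
      (hbr c' hc' hcP') (hbr c hc hcP) hu
  obtain ⟨c₂, h2, hc2, c₃, h3, hc3, hx2, hx3⟩ : ∃ c₂, H.Adj t c₂ ∧ s(t, c₂) ∉ P.edges ∧
      ∃ c₃, H.Adj t c₃ ∧ s(t, c₃) ∉ P.edges ∧ x ∈ branch (H.deleteEdges {s(α, x)}) t c₂ ∧
        x ∉ branch (H.deleteEdges {s(α, x)}) t c₃ := by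
    obtain ⟨a, ha, b, hb, hab, haP, hbP⟩ : ∃ a, H.Adj t a ∧ ∃ b, H.Adj t b ∧ a ≠ b ∧
        s(t, a) ∉ P.edges ∧ s(t, b) ∉ P.edges := by
      obtain ⟨c₁, -, h1⟩ := exists_adj_ne (R.two_le t) t
      obtain ⟨c₂, h21, h2⟩ := exists_adj_ne (R.two_le t) c₁
      obtain ⟨c₃, h31, h32, h3⟩ := exists_adj_ne_ne ht.2.1 c₁ c₂
      have := hedge c₁ c₂; have := hedge c₁ c₃; have := hedge c₂ c₃
      by_cases s(t, c₁) ∈ P.edges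
      · exact ⟨c₂, h2, c₃, h3, by grind, by grind, by grind⟩
      by_cases s(t, c₂) ∈ P.edges
      · exact ⟨c₁, h1, c₃, h3, by grind, by grind, by grind⟩
      · exact ⟨c₁, h1, c₂, h2, by grind, by grind, by grind⟩
    have d := hdis a b hab ha hb haP hbP
    have m1 := hω a ha haP
    have m2 := hω b hb hbP
    by_cases hxa : x ∈ branch (H.deleteEdges {s(α, x)}) t a
    · exact ⟨a, ha, haP, b, hb, hbP, hxa, d x hxa⟩
    · refine ⟨b, hb, hbP, a, ha, haP, ?_, hxa⟩
      exact m2.resolve_right (d ω (m1.resolve_left hxa))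
  -- With a third neighbour `x₂` of `α`, remove `αx₂` instead of `αx`: then `tc₂` lies on a closed
  -- walk through `x`, `α` and `P`, so it is no bridge. Otherwise the branch at `c₃` provides the
  -- special vertex, and `t` separates `α` from `x` in `H - αx`.
  by_cases hd : ∃ x₂, H.Adj α x₂ ∧ x₂ ≠ x ∧ x₂ ≠ x'
  · obtain ⟨x₂, hx₂, hx₂x, hx₂x'⟩ := hd
    refine hno (hdet x₂ c₂ hx₂ hx₂x' h2 hc2 ?_)
    have hsub : branch (H.deleteEdges {s(α, x)}) t c₂ ⊆
        branch (H.deleteEdges {s(α, x₂)}) t c₂ := by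
      refine branch_induction (self_mem_branch _ _) fun u hub hu w huw _ hw => ?_
      have hαu : u ≠ α := fun h => hαb c₂ h2 hc2 (h ▸ hub)
      have hαw : w ≠ α := fun h => hαb c₂ h2 hc2 (h ▸ hw)
      refine mem_branch_of_adj hu (deleteEdges_singleton_adj (hle huw) ?_)
        (Or.inl fun h => hbr c₂ h2 hc2 (h ▸ hw))
      simp only [ne_eq, Sym2.eq_iff]
      tauto
    have hα2 : α ∈ branch (H.deleteEdges {s(α, x₂)}) t c₂ := by
      refine mem_branch_of_adj (hsub hx2) (deleteEdges_singleton_adj hx.symm ?_)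
        (Or.inl ht.1.symm)
      have := hx.ne
      simp only [ne_eq, Sym2.eq_iff]
      grind
    by_contra htb
    have hP2 : ∀ e ∈ P.edges, e ∈ (H.deleteEdges {s(α, x₂)}).edgeSet := by
      intro e he
      rw [edgeSet_deleteEdges]
      exact ⟨P.edges_subset_edgeSet he, fun h => hoff x₂ hx₂x' (h ▸ he)⟩
    exact notMem_branch_of_walk (P.transfer _ hP2) (by simpa using hc2) htb hα2
  · push Not at hd
    have hα : ∀ z, H.Adj α z → z = x ∨ z = x' := fun z hz => by
      have := hd z hz
      tauto
    have hd3 := degree_lt_three hα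
    obtain ⟨w, hw, y, hy, hws, hwy, hwb⟩ := exists_special_of_branch R.two_le
      (fun w hwα hwx hw => absurd (base_mem_branch (hwα.symm) hwx ht.1 hw) (hαb c₃ h3 hc3))
      ((deleteEdges_base_adj ht.1 (hxt x hx hxx)).2 h3) (hbr c₃ h3 hc3) (hαb c₃ h3 hc3) hx3
    refine hno (detected_of_separates hws hx (hle hwy) (fun h => hαb c₃ h3 hc3 (h ▸ hy))
      (connected_deleteEdges_of_mem_branch hG hwb) P hP (hoff x hxx) (fun he => ?_) fun p => ?_)
    · refine support_disjoint_branch (P.transfer _ hPe) (by simpa using hc3) (hαb c₃ h3 hc3) w ?_ hw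
      simpa using P.fst_mem_support_of_mem_edges he
    · exact (mem_support_of_mem_branch p (hαb c₂ h2 hc2) hx2).1

end EdgeRecon

/-! ### Exchanging twins, and consequences of detection -/

namespace EdgeRecon

open SimpleGraph Classical

section Automorphisms

variable {W : Type*} {H : SimpleGraph W}

/-- An involution that preserves adjacency, as an automorphism. -/
def isoOfInvolutive (f : W → W) (hf : Function.Involutive f)
    (h : ∀ a b, H.Adj a b → H.Adj (f a) (f b)) : H ≃g H where
  toEquiv := hf.toPerm
  map_rel_iff' := by
    intro a b
    refine ⟨fun hab => ?_, h a b⟩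
    have := h _ _ hab
    simpa [hf a, hf b] using this

/-- The transposition of two twins is an automorphism, whether or not they are adjacent. -/
lemma exists_iso_swap {α a b : W} (ha : a ≠ α) (hb : b ≠ α)
    (h : ∀ z, z ≠ a → z ≠ b → (H.Adj a z ↔ H.Adj b z)) :
    ∃ σ : H ≃g H, σ α = α ∧ σ a = b := by
  refine ⟨isoOfInvolutive (Equiv.swap a b) (fun z => Equiv.swap_apply_self a b z) ?_, ?_, ?_⟩
  · intro u w huw
    have hs := h u
    have hs' := h w
    have h1 := huw.ne
    have h2 := huw.symm
    have h3 := H.adj_comm a b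
    have h4 := H.adj_comm a u
    have h5 := H.adj_comm b u
    simp only [Equiv.swap_apply_def]
    split_ifs <;> grind
  · exact Equiv.swap_apply_of_ne_of_ne ha.symm hb.symm
  · exact Equiv.swap_apply_left a b

end Automorphisms

section Walks

variable {W : Type*} {G : SimpleGraph W}

lemma exists_walk_of_mem_branch {v c u : W} (hu : u ∈ branch G v c) :
    ∃ q : G.Walk c u, ∀ z ∈ q.support, z ∈ branch G v c := by
  obtain ⟨q⟩ := hu
  refine ⟨q.mapLe (deleteEdges_le _), fun z hz => ?_⟩
  obtain ⟨r, -, -⟩ := exists_append_of_mem_support q (by simpa using hz)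
  exact r.reachable

lemma reachable_deleteEdges_of_walk {e : Sym2 W} {u w : W} (p : G.Walk u w) (he : e ∉ p.edges) :
    (G.deleteEdges {e}).Reachable u w := by
  refine ⟨p.transfer _ fun e' he' => ?_⟩
  rw [edgeSet_deleteEdges]
  exact ⟨p.edges_subset_edgeSet he', fun h => he (h ▸ he')⟩

lemma exists_walk_deleteEdges {e : Sym2 W} {u w : W} (p : G.Walk u w) (he : e ∉ p.edges) :
    ∃ q : (G.deleteEdges {e}).Walk u w, q.edges = p.edges ∧ q.support = p.support := by
  refine ⟨p.transfer _ fun e' he' => ?_, Walk.edges_transfer _ _, Walk.support_transfer _ _⟩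
  rw [edgeSet_deleteEdges]
  exact ⟨p.edges_subset_edgeSet he', fun h => he (h ▸ he')⟩

end Walks

variable {W : Type u} {H : SimpleGraph W} {α ω ω' t t' : W}

lemma notMem_edges_of_concat {x y₀ : W} {P₀ : H.Walk α y₀} {h₀ : H.Adj y₀ t} (hx : s(α, x) ∉ (P₀.concat h₀).edges) :
    s(α, x) ∉ P₀.edges := fun h => hx (by simp [Walk.edges_concat, h])

variable [Fintype W]

lemma eq_of_detected {P : H.Walk α t} {P' : H.Walk α t'} (hov : OverlapsAgree H α P.edges P'.edges)
    (hd : Detected H α P.edges) (hlen : P'.length ≤ P.length) : t = t' := by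
  obtain ⟨s, rfl⟩ := exists_append_of_edges P P' (hov.transfer hd (List.prefix_refl _))
  rw [Walk.length_append] at hlen
  exact Walk.eq_of_length_eq_zero (p := s) (by omega)

/-- If the way a path would have to continue is also detected, then the path cannot be continued. -/
lemma eq_of_detected_concat {P : H.Walk α t} {P' : H.Walk α t'} {y : W} (hP' : P'.IsPath)
    (hov : OverlapsAgree H α P.edges P'.edges) (ht : t ≠ α) (hdeg : H.degree t = 2)
    (hy : H.Adj t y) (hyP : s(t, y) ∉ P.edges) (hd : Detected H α (P.edges ++ [s(t, y)])) :
    t = t' := by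
  obtain ⟨s, rfl⟩ := exists_append_of_edges P P'
    (hov.transfer (hd.mono (List.prefix_append _ _)) (List.prefix_refl _))
  cases s with
  | nil => rfl
  | @cons _ z _ hz s =>
    exfalso
    obtain ⟨y₀, P₀, h₀, rfl⟩ := exists_eq_concat P ht.symm
    -- At a vertex of degree two the path can only go on along the unused edge.
    have hzy : z = y := by
      have hy0 : y₀ ≠ y := by
        rintro rfl
        exact hyP (by simp [Walk.edges_concat, Sym2.eq_swap])
      refine (eq_or_eq_of_degree_eq_two hdeg h₀.symm hy hy0 hz).resolve_left ?_
      rintro rfl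
      have := hP'.isTrail.edges_nodup
      rw [Walk.edges_append, Walk.edges_concat, Walk.edges_cons, List.nodup_append] at this
      exact this.2.2 s(z, t) (by simp) s(t, z) (by simp) Sym2.eq_swap
    subst hzy
    -- The detected list starts `P'`, hence also `P`, but it is longer than `P`.
    have := hov.symm.transfer hd (by simp [Walk.edges_append])
    have := this.length_le
    simp at this

/-- The data of a geodesic to a vertex of degree two. -/
lemma exists_last {P : H.Walk α t} (hP : P.length = H.dist α t) (ht : t ≠ α)
    (hdeg : H.degree t = 2) :
    ∃ (y₀ : W) (P₀ : H.Walk α y₀) (h₀ : H.Adj y₀ t) (y₁ : W), P = P₀.concat h₀ ∧ H.Adj t y₁ ∧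
      y₁ ≠ y₀ ∧ y₁ ≠ α ∧ y₁ ∉ P.support := by
  have hpath := P.isPath_of_length_eq_dist hP
  obtain ⟨y₀, P₀, h₀, rfl⟩ := exists_eq_concat P ht.symm
  obtain ⟨y₁, h10, h1⟩ := exists_adj_ne hdeg.ge y₀
  have hsupp : y₁ ∉ (P₀.concat h₀).support := by
    intro hmem
    have := mem_edges_of_geodesic hP h1.symm hmem
    exact h10 (Walk.IsPath.eq_of_end_edges hpath (x := y₁) (y := y₀)
      (by rwa [Sym2.eq_swap]) (by simp [Walk.edges_concat, Sym2.eq_swap]))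
  refine ⟨y₀, P₀, h₀, y₁, rfl, h1, h10, ?_, hsupp⟩
  rintro rfl
  exact hsupp (Walk.start_mem_support _)

section DegreeTwoTarget

variable {x y₀ y₁ : W}

/-- The unused edge at the end of a path is detected if it ends in a special vertex. -/
lemma detected_next (R : Reduced H α ω ω') {P : H.Walk α t} (hP : P.IsPath) (ht : t ≠ α)
    (hx : H.Adj α x) (hxP : s(α, x) ∉ P.edges) (h1 : H.Adj t y₁) (h1P : y₁ ∉ P.support)
    (q : (H.deleteEdges {s(α, x)}).Walk y₁ α) (hq : t ∉ q.support)
    (hs : IsSpecialVertex H α y₁) : Detected H α (P.edges ++ [s(t, y₁)]) := by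
  have h1e : s(y₁, t) ∉ P.edges := fun h => h1P (P.fst_mem_support_of_mem_edges h)
  obtain ⟨P₁, hP₁, -⟩ := exists_walk_deleteEdges P hxP
  -- Here `e_v` is the edge from `y₁` to `t`; it lies on the closed walk formed by `q`, `P` and this
  -- edge.
  refine detected_concat hs hx h1.symm ht
    (connected_deleteEdges_of_mem_branch (R.connected_deleteEdges x) ?_) P hP hxP h1e Sym2.eq_swap
  refine Reachable.symm (Reachable.trans
    (reachable_deleteEdges_of_walk q fun h => hq (q.snd_mem_support_of_mem_edges h))
    (reachable_deleteEdges_of_walk P₁ (hP₁ ▸ h1e)))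

/-- A path to a vertex of degree two is detected if its last but one vertex is special. -/
lemma detected_of_penultimate (R : Reduced H α ω ω') {P₀ : H.Walk α y₀} {h₀ : H.Adj y₀ t}
    (hP : (P₀.concat h₀).IsPath) (ht : t ≠ α) (hx : H.Adj α x)
    (hxP : s(α, x) ∉ (P₀.concat h₀).edges) (h1 : H.Adj t y₁) (h10 : y₁ ≠ y₀) (h1α : y₁ ≠ α)
    (q : (H.deleteEdges {s(α, x)}).Walk y₁ α) (hq : t ∉ q.support)
    (hs : IsSpecialVertex H α y₀) : Detected H α (P₀.concat h₀).edges := by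
  have hP' := hP
  rw [Walk.concat_isPath_iff] at hP'
  have h0e : s(y₀, t) ∉ P₀.edges := fun h => hP'.2 (P₀.snd_mem_support_of_mem_edges h)
  obtain ⟨P₁, hP₁, -⟩ := exists_walk_deleteEdges P₀ (notMem_edges_of_concat hxP)
  rw [Walk.edges_concat, List.concat_eq_append]
  -- Here `e_v` is the last edge of the path; it lies on the closed walk through `y₁`, `q` and `P₀`.
  refine detected_concat hs hx h₀ ht
    (connected_deleteEdges_of_mem_branch (R.connected_deleteEdges x) ?_) P₀ hP'.1
    (notMem_edges_of_concat hxP) h0e rfl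
  have h3 : ((H.deleteEdges {s(α, x)}).deleteEdges {s(y₀, t)}).Reachable t y₁ := by
    refine (deleteEdges_singleton_adj (deleteEdges_singleton_adj h1 ?_) ?_).reachable
    · simp only [ne_eq, Sym2.eq_iff]
      tauto
    · have := h1.ne
      simp only [ne_eq, Sym2.eq_iff]
      tauto
  exact (h3.trans (reachable_deleteEdges_of_walk q
    fun h => hq (q.snd_mem_support_of_mem_edges h))).trans
    (reachable_deleteEdges_of_walk P₁ (hP₁ ▸ h0e))

/-- The unused edge at the end of a path is detected if it ends in a vertex of degree two with
special second neighbour. -/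
lemma detected_next_next (R : Reduced H α ω ω') {P : H.Walk α t} (hP : P.IsPath) (ht : t ≠ α)
    (hx : H.Adj α x) (hxP : s(α, x) ∉ P.edges) (h1 : H.Adj t y₁) (h1α : y₁ ≠ α)
    (h1P : y₁ ∉ P.support) (q : (H.deleteEdges {s(α, x)}).Walk y₁ α) (hq : t ∉ q.support)
    (h1d : H.degree y₁ = 2) {z : W} (hz : H.Adj y₁ z) (hzt : z ≠ t)
    (hs : IsSpecialVertex H α z) : Detected H α (P.edges ++ [s(t, y₁)]) := by
  have hzP : s(z, y₁) ∉ P.edges := fun h => h1P (P.snd_mem_support_of_mem_edges h)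
  obtain ⟨P₁, hP₁, -⟩ := exists_walk_deleteEdges P hxP
  have hconn : ((H.deleteEdges {s(α, x)}).deleteEdges {s(z, y₁)}).Connected := by
    refine connected_deleteEdges_of_mem_branch (R.connected_deleteEdges x) ?_
    have h3 : ((H.deleteEdges {s(α, x)}).deleteEdges {s(z, y₁)}).Reachable y₁ t := by
      refine (deleteEdges_singleton_adj (deleteEdges_singleton_adj h1.symm ?_) ?_).reachable
      · simp only [ne_eq, Sym2.eq_iff]
        tauto
      · have := h1.ne
        simp only [ne_eq, Sym2.eq_iff]
        tauto
    refine (h3.trans (reachable_deleteEdges_of_walk P₁ (hP₁ ▸ hzP)).symm).trans (Reachable.symm ?_)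
    -- The path to `α` avoids `t`, so it must leave `y₁`, a vertex of degree two, through `z`. Hence
    -- the edge `zy₁` lies on a closed walk.
    have hq' := fun h => hq (q.support_bypass_subset_support h)
    have hqp := q.bypass_isPath
    obtain ⟨w, hw, r, hr⟩ := exists_eq_cons q.bypass h1α
    rw [hr] at hq' hqp
    rw [Walk.cons_isPath_iff] at hqp
    have hwz : w = z := by
      refine (eq_or_eq_of_degree_eq_two h1d h1.symm hz hzt.symm
        (deleteEdges_le _ hw)).resolve_left ?_
      rintro rfl
      exact hq' (by simp)
    subst hwz
    exact reachable_deleteEdges_of_walk r fun h => hqp.2 (r.snd_mem_support_of_mem_edges h)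
  have := detected_concat hs hx hz.symm h1α hconn (P.concat h1)
    ((Walk.concat_isPath_iff h1).2 ⟨hP, h1P⟩)
    (by
      rw [Walk.edges_concat, List.concat_eq_append, List.mem_append, not_or]
      refine ⟨hxP, ?_⟩
      simp only [List.mem_singleton, Sym2.eq_iff]
      tauto)
    (by
      rw [Walk.edges_concat, List.concat_eq_append, List.mem_append, not_or]
      refine ⟨hzP, ?_⟩
      simp only [List.mem_singleton, Sym2.eq_iff]
      have := h1.ne
      tauto)
    (t' := z) Sym2.eq_swap
  rw [Walk.edges_concat, List.concat_eq_append] at this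
  exact this.mono (List.prefix_append _ _)

/-- Either the unused edge at the end of the path is a bridge, or one can go from it to `α`
without coming back. -/
lemma exists_walk_or_bridge {P₀ : H.Walk α y₀} {h₀ : H.Adj y₀ t}
    (hP : (P₀.concat h₀).IsPath) (hxP : s(α, x) ∉ (P₀.concat h₀).edges)
    (hdeg : H.degree t = 2) (h1 : H.Adj t y₁) (h10 : y₁ ≠ y₀) (ht : t ≠ α) :
    (∃ q : (H.deleteEdges {s(α, x)}).Walk y₁ α, t ∉ q.support) ∨
      (α ∉ branch (H.deleteEdges {s(α, x)}) t y₁ ∧ t ∉ branch (H.deleteEdges {s(α, x)}) t y₁) := by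
  by_contra hcon
  push Not at hcon
  obtain ⟨hno, hbr⟩ := hcon
  rw [Walk.concat_isPath_iff] at hP
  obtain ⟨P₁, -, hP₁⟩ := exists_walk_deleteEdges P₀ (notMem_edges_of_concat hxP)
  have hsub : branch (H.deleteEdges {s(α, x)}) t y₁ ⊆
      {u | ∃ q : (H.deleteEdges {s(α, x)}).Walk y₁ u, t ∉ q.support} := by
    refine branch_induction ⟨Walk.nil, by simpa using h1.ne⟩ ?_
    rintro u - ⟨q, hq⟩ w huw hne -
    by_cases hwt : w = t
    · subst hwt
      rcases eq_or_eq_of_degree_eq_two hdeg h₀.symm h1 h10.symm (deleteEdges_le _ huw).symm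
        with rfl | rfl
      -- A walk that reaches `y₀` without `t` could go on to `α` along `P₀`, still without `t`.
      · have := hno (q.append P₁.reverse)
        simp [Walk.mem_support_append_iff, hq, hP₁, hP.2] at this
      · exact absurd Sym2.eq_swap hne
    · refine ⟨q.concat huw, ?_⟩
      rw [Walk.support_concat]
      simpa [hq] using Ne.symm hwt
  have hα : α ∉ branch (H.deleteEdges {s(α, x)}) t y₁ := fun h => by
    obtain ⟨q, hq⟩ := hsub h
    exact hq (hno q)
  obtain ⟨q, hq⟩ := hsub (hbr hα)
  exact hq q.end_mem_support

end DegreeTwoTarget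

/-- Over a base vertex of degree two, the first edge of the paths is determined, if there is a
special vertex. -/
lemma detected_first {x x' v : W} (R : Reduced H α ω ω') (hx : H.Adj α x)
    (hα : ∀ z, H.Adj α z → z = x ∨ z = x') (hv : IsSpecialVertex H α v) {l : List (Sym2 W)}
    (h : ∀ p : (H.deleteEdges {s(α, x)}).Walk α x, p.IsPath → l <+: p.edges) :
    Detected H α l := by
  obtain ⟨w, y, hw, hwy, -, hyα, hc⟩ := exists_special_edge_of_degree_two R hx hα hv Walk.nil
    Walk.IsPath.nil (fun hmem => absurd (by simpa using hmem) hv.1)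
  exact detected_of_forall_path hw hx hwy hyα hc h

/-- If `b ≠ b'`, these are the only neighbours of `α`, and every path from `α` to `b'` without the
edge `αb'` starts with `αb`. So this edge is detected, and the second walk would start with it. -/
lemma first_eq {b b' v : W} (R : Reduced H α ω ω') (hd : H.degree α = 2)
    (hv : IsSpecialVertex H α v) {hb : H.Adj α b} {hb' : H.Adj α b'} {P : H.Walk b t}
    {P' : H.Walk b' t'}
    (hov : OverlapsAgree H α (Walk.cons hb P).edges (Walk.cons hb' P').edges) : b = b' := by
  by_contra hne
  have hα : ∀ z, H.Adj α z → z = b' ∨ z = b := fun z hz =>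
    (eq_or_eq_of_degree_eq_two hd hb hb' hne hz).symm
  have hdet : Detected H α [s(α, b)] := by
    refine detected_first R hb' hα hv fun p hp => ?_
    obtain ⟨c, hc, p, rfl⟩ := exists_eq_cons p hb'.ne
    have hcb : c = b := by
      refine (hα c (deleteEdges_le _ hc)).resolve_left ?_
      rintro rfl
      simp at hc
    subst hcb
    simp
  have := hov.transfer hdet (by simp)
  rw [Walk.edges_cons, List.cons_prefix_cons] at this
  have h2 := this.1
  have := hb.ne
  have := hb'.ne
  simp only [Sym2.eq_iff] at h2
  tauto

end EdgeRecon

/-! ### The overlaps determine the end of a geodesic up to automorphism -/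

namespace EdgeRecon

open SimpleGraph Classical

variable {W : Type u} {H : SimpleGraph W} {α ω ω' t t' : W}

lemma length_eq_one_of_adj {P : H.Walk α t} (hP : P.length = H.dist α t) (h : H.Adj t α) :
    P.length = 1 := by
  rw [hP, dist_eq_one_iff_adj]
  exact h.symm

lemma length_pos_of_ne {P : H.Walk α t} (h : t ≠ α) : 1 ≤ P.length := by
  by_contra hlt
  exact h (Walk.eq_of_length_eq_zero (p := P) (by omega)).symm

lemma eq_of_concat_eq_cons {y b : W} {P₀ : H.Walk α y} {h₀ : H.Adj y t} {hb : H.Adj α b}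
    {P : H.Walk b t} (h : P₀.concat h₀ = Walk.cons hb P) (hlen : P₀.length = 1) : y = b := by
  cases P₀ with
  | nil => simp at hlen
  | cons h' r =>
    obtain rfl := Walk.eq_of_length_eq_zero (p := r) (by simpa using hlen)
    have := congrArg Walk.edges h
    rw [Walk.edges_cons, Walk.edges_concat, Walk.edges_cons, List.concat_eq_append,
      List.cons_append, List.cons.injEq] at this
    have h1 := this.1
    have := hb.ne
    simp only [Sym2.eq_iff] at h1
    grind

variable [Fintype W]

/-- If `t'` is special too, both geodesics are detected, and each is an initial segment of the
other. If not, its degree forces it to be adjacent to `α`, so `P'` has length one. -/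
lemma eq_of_special (R : Reduced H α ω ω') {P : H.Walk α t} {P' : H.Walk α t'}
    (hP : P.length = H.dist α t) (hP' : P'.length = H.dist α t') (ht' : t' ≠ α)
    (hov : OverlapsAgree H α P.edges P'.edges) (ht : IsSpecialVertex H α t)
    (hdeg : H.degree t' = H.degree t) : t = t' := by
  have hd := detected_of_special R ht P (P.isPath_of_length_eq_dist hP) (length_eq_one_of_adj hP)
  refine eq_of_detected hov hd ?_
  by_cases hs : IsSpecialVertex H α t'
  · have hd' := detected_of_special R hs P' (P'.isPath_of_length_eq_dist hP')
      (length_eq_one_of_adj hP')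
    simpa using (hov.symm.transfer hd' (List.prefix_refl _)).length_le
  · have hadj : H.Adj t' α := by
      by_contra hna
      exact hs ⟨ht', hdeg ▸ ht.2.1, fun h => absurd h hna⟩
    rw [length_eq_one_of_adj hP' hadj]
    exact length_pos_of_ne ht.1

/-- Every vertex of degree at least three other than `α` is special here. One looks for one of them
next to the end of `P`. -/
lemma eq_of_degree_two_of_three_le (R : Reduced H α ω ω') {P : H.Walk α ω} {P' : H.Walk α ω'}
    (hP : P.length = H.dist α ω) (hP' : P'.length = H.dist α ω')
    (hov : OverlapsAgree H α P.edges P'.edges) (hα : 3 ≤ H.degree α) (hω : H.degree ω = 2) :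
    ω = ω' := by
  by_contra hne
  have hpath := P.isPath_of_length_eq_dist hP
  have hpath' := P'.isPath_of_length_eq_dist hP'
  have hspecial : ∀ v, v ≠ α → H.degree v ≠ 2 → IsSpecialVertex H α v := by
    intro v hv h2
    have := R.two_le v
    exact ⟨hv, by omega, fun _ => hα⟩
  have hω' : H.degree ω' = 2 := R.degree_eq.trans hω
  obtain ⟨y₀, P₀, h₀, y₁, rfl, h1, h10, h1α, h1P⟩ := exists_last hP R.ne hω
  have h1e : s(ω, y₁) ∉ (P₀.concat h₀).edges :=
    fun h => h1P (Walk.snd_mem_support_of_mem_edges _ h)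
  have hfin : Detected H α ((P₀.concat h₀).edges ++ [s(ω, y₁)]) → False :=
    fun h => hne (eq_of_detected_concat hpath' hov R.ne hω h1 h1e h)
  obtain ⟨b, hb, P₂, hP₂⟩ := exists_eq_cons (P₀.concat h₀) R.ne.symm
  have hoff : ∀ x, x ≠ b → s(α, x) ∉ (P₀.concat h₀).edges := fun x hx h =>
    hx (Walk.IsPath.eq_of_start_edges hpath h (by rw [hP₂]; simp))
  obtain ⟨x, hx, hxb, q, hq⟩ : ∃ x, H.Adj α x ∧ x ≠ b ∧
      ∃ q : (H.deleteEdges {s(α, x)}).Walk y₁ α, ω ∉ q.support := by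
    obtain ⟨x, hxb, hx⟩ := exists_adj_ne (R.two_le α) b
    rcases exists_walk_or_bridge hpath (hoff x hxb) hω h1 h10 R.ne with hq | ⟨hαb, hωb⟩
    · exact ⟨x, hx, hxb, hq⟩
    -- Since `ωy₁` is a bridge of `H - αx`, the branch behind it must contain `x`. After removing
    -- another edge `αx₂` instead, the way from `y₁` to `x` continues to `α`.
    · have hxb' : x ∈ branch (H.deleteEdges {s(α, x)}) ω y₁ := by
        by_contra hxn
        exact hωb (mem_branch_of_conn R h1.ne' hαb hxn)
      obtain ⟨x₂, hx2x, hx2b, hx2⟩ := exists_adj_ne_ne hα x b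
      obtain ⟨q, hq⟩ := exists_walk_of_mem_branch hxb'
      have hqα : α ∉ q.support := fun h => hαb (hq _ h)
      have hqω : ω ∉ q.support := fun h => hωb (hq _ h)
      obtain ⟨q', -, hq'⟩ := exists_walk_deleteEdges (q.mapLe (deleteEdges_le _))
        (e := s(α, x₂)) fun h => hqα (by simpa using Walk.fst_mem_support_of_mem_edges _ h)
      have hxα : (H.deleteEdges {s(α, x₂)}).Adj x α := by
        refine deleteEdges_singleton_adj hx.symm ?_
        have := hx.ne
        simp only [ne_eq, Sym2.eq_iff]
        grind
      refine ⟨x₂, hx2, hx2b, q'.concat hxα, ?_⟩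
      rw [Walk.support_concat, hq']
      simpa [hqω] using R.ne
  have hxP := hoff x hxb
  by_cases h1d : H.degree y₁ = 2
  · have hy1 : y₁ = ω' := by
      have := R.adj_two ω y₁ h1 R.ne h1α hω h1d
      tauto
    obtain ⟨z, hzω, hz⟩ := exists_adj_ne h1d.ge ω
    -- Here `ω` and `ω' = y₁` are adjacent vertices of degree two. If `ω'` is also adjacent to `α`,
    -- then `P'` has length one and it suffices to detect `P` through its last but one vertex `y₀`.
    -- If `y₀` were `α`, then `α` would separate `ω` and `ω'` from its third neighbour.
    by_cases hzα : z = α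
    · have hlen := length_eq_one_of_adj hP' (by rw [← hy1, ← hzα]; exact hz)
      have h0α : y₀ ≠ α := by
        rintro rfl
        have hcl : ∀ u ∈ ({ω, y₁} : Set W), ∀ w, (H.deleteIncidenceSet y₀).Adj u w →
            w ∈ ({ω, y₁} : Set W) := by
          rintro u (rfl | rfl) w hw <;> rw [deleteIncidenceSet_adj] at hw
          · exact Or.inr ((eq_or_eq_of_degree_eq_two hω h₀.symm h1 h10.symm hw.1).resolve_left
              hw.2.2)
          · exact Or.inl ((eq_or_eq_of_degree_eq_two h1d h1.symm hz hzω.symm hw.1).resolve_right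
              (hzα ▸ hw.2.2))
        obtain ⟨u, hu1, hu2, hu⟩ := exists_adj_ne_ne hα ω y₁
        rcases R.conn y₀ u hu.ne' with h | h
        · exact reachable_deleteIncidenceSet_ne hu.ne' h rfl
        · exact (mem_of_reachable hcl h.symm (Or.inl rfl)).elim hu1 hu2
      have h0d : H.degree y₀ ≠ 2 := by
        intro h0d
        have := R.adj_two ω y₀ h₀.symm R.ne h0α hω h0d
        have := h₀.ne
        grind
      refine hne (eq_of_detected hov (detected_of_penultimate R hpath R.ne hx hxP h1 h10 h1α q hq
        (hspecial _ h0α h0d)) ?_)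
      rw [hlen]
      exact length_pos_of_ne R.ne
    · have hzd : H.degree z ≠ 2 := by
        intro hzd
        have := R.adj_two y₁ z hz h1α hzα h1d hzd
        have := h1.ne
        grind
      exact hfin (detected_next_next R hpath R.ne hx hxP h1 h1α h1P q hq h1d hz hzω
        (hspecial z hzα hzd))
  · exact hfin (detected_next R hpath R.ne hx hxP h1 h1P q hq (hspecial y₁ h1α h1d))

/-- If `α` has degree two and one of the walks is just the edge to a vertex of degree two, then
the walks have the same end. -/
lemma eq_of_adj_degree_two {v : W} (R : Reduced H α ω ω') {P : H.Walk α t} {P' : H.Walk α t'}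
    (hP : P.length = 1) (htα : t ≠ α) (hP' : P'.IsPath) (ht' : t' ≠ α)
    (hov : OverlapsAgree H α P.edges P'.edges) (hdα : H.degree α = 2) (ht : H.degree t = 2)
    (hv : IsSpecialVertex H α v) : t = t' := by
  by_contra hne
  obtain ⟨b, hb, Q, rfl⟩ := exists_eq_cons P htα.symm
  obtain ⟨b', hb', Q', rfl⟩ := exists_eq_cons P' ht'.symm
  obtain rfl := first_eq R hdα hv hov
  obtain rfl := Walk.eq_of_length_eq_zero (p := Q) (by simpa using hP)
  obtain ⟨x, hxb, hx⟩ := exists_adj_ne hdα.ge b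
  have hα : ∀ z, H.Adj α z → z = x ∨ z = b := fun z hz =>
    eq_or_eq_of_degree_eq_two hdα hx hb hxb hz
  obtain ⟨y, hyα, hy⟩ := exists_adj_ne ht.ge α
  have hcont : ∀ d, H.Adj b d → d ≠ α → d = y := fun d hd hdα =>
    (eq_or_eq_of_degree_eq_two ht hb.symm hy hyα.symm hd).resolve_left hdα
  -- Paths from `α` to `x` without `αx` have no choice in their first two steps, and neither has
  -- `P'` if it does not end in `b`.
  have hdet : Detected H α [s(α, b), s(b, y)] := by
    refine detected_first R hx hα hv fun p hp => ?_
    obtain ⟨c, hc, p, rfl⟩ := exists_eq_cons p hx.ne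
    have hcb : c = b := by
      refine (hα c (deleteEdges_le _ hc)).resolve_left ?_
      rintro rfl
      simp at hc
    subst hcb
    obtain ⟨d, hd, p, rfl⟩ := exists_eq_cons p hxb.symm
    rw [Walk.cons_isPath_iff] at hp
    obtain rfl := hcont d (deleteEdges_le _ hd) (by rintro rfl; exact hp.2 (by simp))
    simp
  obtain ⟨d, hd, Q', rfl⟩ := exists_eq_cons Q' hne
  rw [Walk.cons_isPath_iff] at hP'
  obtain rfl := hcont d hd (by rintro rfl; exact hP'.2 (by simp))
  have := (hov.symm.transfer hdet (by simp)).length_le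
  rw [Walk.length_edges, hP] at this
  simp at this

/-- Both geodesics start with the same edge `αb`. If `x` is the other neighbour of `α`, the vertices
of degree at least three other than `α`, `x`, `b` are special. Trouble comes only from `x` and `b`,
which need not be special; but if they are adjacent to `ω` or `ω'`, that vertex has distance two
from `α`. -/
lemma exists_iso_of_degree_two {v : W} (R : Reduced H α ω ω') (hne : ω ≠ ω') {P : H.Walk α ω}
    {P' : H.Walk α ω'} (hP : P.length = H.dist α ω) (hP' : P'.length = H.dist α ω')
    (hov : OverlapsAgree H α P.edges P'.edges) (hdα : H.degree α = 2) (hω : H.degree ω = 2)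
    (hωα : ¬ H.Adj ω α) (hωα' : ¬ H.Adj ω' α) (hv : IsSpecialVertex H α v) :
    ∃ σ : H ≃g H, σ α = α ∧ σ ω = ω' := by
  have hpath := P.isPath_of_length_eq_dist hP
  have hpath' := P'.isPath_of_length_eq_dist hP'
  have hω' : H.degree ω' = 2 := R.degree_eq.trans hω
  obtain ⟨y₀, P₀, h₀, y₁, rfl, h1, h10, h1α, h1P⟩ := exists_last hP R.ne hω
  obtain ⟨z₀, Q₀, k₀, z₁, rfl, k1, k10, k1α, k1P⟩ := exists_last hP' R.ne' hω'
  obtain ⟨b, hb, P₂, hP₂⟩ := exists_eq_cons (P₀.concat h₀) R.ne.symm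
  obtain ⟨b', hb', Q₂, hQ₂⟩ := exists_eq_cons (Q₀.concat k₀) R.ne'.symm
  obtain rfl : b = b' := by
    rw [hP₂, hQ₂] at hov
    exact first_eq R hdα hv hov
  have h1e : s(ω, y₁) ∉ (P₀.concat h₀).edges :=
    fun h => h1P (Walk.snd_mem_support_of_mem_edges _ h)
  have hfin : Detected H α ((P₀.concat h₀).edges ++ [s(ω, y₁)]) → False :=
    fun h => hne (eq_of_detected_concat hpath' hov R.ne hω h1 h1e h)
  obtain ⟨x, hxb, hx⟩ := exists_adj_ne hdα.ge b
  have hα : ∀ z, H.Adj α z → z = x ∨ z = b := fun z hz =>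
    eq_or_eq_of_degree_eq_two hdα hx hb hxb hz
  have hxP : s(α, x) ∉ (P₀.concat h₀).edges := fun h =>
    hxb (Walk.IsPath.eq_of_start_edges hpath h (by rw [hP₂]; simp))
  have hxQ : s(α, x) ∉ (Q₀.concat k₀).edges := fun h =>
    hxb (Walk.IsPath.eq_of_start_edges hpath' h (by rw [hQ₂]; simp))
  have hspecial : ∀ v, v ≠ α → v ≠ x → v ≠ b → H.degree v ≠ 2 → IsSpecialVertex H α v := by
    intro v hv hvx hvb h2
    have := R.two_le v
    exact ⟨hv, by omega, fun h => absurd (hα v h.symm) (by tauto)⟩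
  have h0α : y₀ ≠ α := by
    rintro rfl
    exact hωα h₀.symm
  have k0α : z₀ ≠ α := by
    rintro rfl
    exact hωα' k₀.symm
  have hlen : 2 ≤ (P₀.concat h₀).length := by
    rw [Walk.length_concat]
    exact Nat.succ_le_succ (length_pos_of_ne h0α)
  have hlen' : 2 ≤ (Q₀.concat k₀).length := by
    rw [Walk.length_concat]
    exact Nat.succ_le_succ (length_pos_of_ne k0α)
  have hωx : ω ≠ x := by
    rintro rfl
    exact hωα hx.symm
  have hωb : ω ≠ b := by
    rintro rfl
    exact hωα hb.symm
  have hωx' : ω' ≠ x := by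
    rintro rfl
    exact hωα' hx.symm
  have hωb' : ω' ≠ b := by
    rintro rfl
    exact hωα' hb.symm
  have hdist : ∀ u z, H.Adj u z → z = x ∨ z = b → H.dist α u ≤ 2 := by
    rintro u z hu (rfl | rfl)
    · exact dist_le (Walk.cons hx (Walk.cons hu.symm Walk.nil))
    · exact dist_le (Walk.cons hb (Walk.cons hu.symm Walk.nil))
  have hshort : ∀ z, H.Adj ω z → z = x ∨ z = b → y₀ = b ∧ (P₀.concat h₀).length ≤ 2 := by
    intro z hz hzz
    have h2 : (P₀.concat h₀).length ≤ 2 := hP ▸ hdist ω z hz hzz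
    refine ⟨eq_of_concat_eq_cons hP₂ ?_, h2⟩
    rw [Walk.length_concat] at hlen h2
    omega
  have hshort' : ∀ z, H.Adj ω' z → z = x ∨ z = b → z₀ = b ∧ (Q₀.concat k₀).length ≤ 2 := by
    intro z hz hzz
    have h2 : (Q₀.concat k₀).length ≤ 2 := hP' ▸ hdist ω' z hz hzz
    refine ⟨eq_of_concat_eq_cons hQ₂ ?_, h2⟩
    rw [Walk.length_concat] at hlen' h2
    omega
  have hNω : ∀ z, H.Adj ω z → z = y₀ ∨ z = y₁ := fun z hz =>
    eq_or_eq_of_degree_eq_two hω h₀.symm h1 h10.symm hz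
  have hNω' : ∀ z, H.Adj ω' z → z = z₀ ∨ z = z₁ := fun z hz =>
    eq_or_eq_of_degree_eq_two hω' k₀.symm k1 k10.symm hz
  rcases exists_walk_or_bridge hpath hxP hω h1 h10 R.ne with ⟨q, hq⟩ | ⟨hαB, hωB⟩
  · by_cases h1d : H.degree y₁ = 2
    · have hy1 : y₁ = ω' := by
        have := R.adj_two ω y₁ h1 R.ne h1α hω h1d
        tauto
      obtain ⟨z, hzω, hz⟩ := exists_adj_ne h1d.ge ω
      have hzα : z ≠ α := by
        rintro rfl
        exact hωα' (hy1 ▸ hz)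
      have hzd : H.degree z ≠ 2 := by
        intro hzd
        have := R.adj_two y₁ z hz h1α hzα h1d hzd
        have := h1.ne
        grind
      by_cases hzxb : z = x ∨ z = b
      · obtain ⟨hz0, hlen2⟩ := hshort' z (hy1 ▸ hz) hzxb
        have h0d : H.degree y₀ ≠ 2 := by
          intro h0d
          have := R.adj_two ω y₀ h₀.symm R.ne h0α hω h0d
          have := h₀.ne
          grind
        -- Either `ω` and `ω'` are adjacent twins over `b`, or `y₀` is special and `P` is detected,
        -- while `P'` has length two.
        by_cases h0xb : y₀ = x ∨ y₀ = b
        · obtain ⟨h0b, -⟩ := hshort y₀ h₀.symm h0xb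
          refine exists_iso_swap R.ne R.ne' fun u hu hu' => ?_
          have hk1 : z₁ = ω := by
            rcases hNω' ω (hy1 ▸ h1.symm) with h | h
            · exact absurd (h.trans hz0) hωb
            · exact h.symm
          constructor
          · intro h
            have := hNω u h
            have : u = b := by grind
            rw [this, ← hz0]
            exact k₀.symm
          · intro h
            have := hNω' u h
            have : u = b := by grind
            rw [this, ← h0b]
            exact h₀.symm
        · push Not at h0xb
          exact absurd (eq_of_detected hov (detected_of_penultimate R hpath R.ne hx hxP h1 h10 h1α q
            hq (hspecial _ h0α h0xb.1 h0xb.2 h0d)) (hlen2.trans hlen)) hne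
      · push Not at hzxb
        exact (hfin (detected_next_next R hpath R.ne hx hxP h1 h1α h1P q hq h1d hz hzω
          (hspecial z hzα hzxb.1 hzxb.2 hzd))).elim
    · by_cases h1xb : y₁ = x ∨ y₁ = b
      · obtain ⟨h0b, hlen2⟩ := hshort y₁ h1 h1xb
        have h1x : y₁ = x := h1xb.resolve_right fun h => h10 (h.trans h0b.symm)
        -- Here `ω` has exactly the neighbours `b` and `x`, so `P` has length two. Either `ω'` is a
        -- twin of `ω`, or the roles are exchanged and `P'`, which is at least as long, is detected.
        by_cases hboth : H.Adj ω' x ∧ H.Adj ω' b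
        · refine exists_iso_swap R.ne R.ne' fun u _ _ => ⟨fun h => ?_, fun h => ?_⟩
          · rcases hNω u h with rfl | rfl
            · exact h0b ▸ hboth.2
            · exact h1x ▸ hboth.1
          · rcases eq_or_eq_of_degree_eq_two hω' hboth.1 hboth.2 hxb h with rfl | rfl
            · exact h1x ▸ h1
            · exact h0b ▸ h₀.symm
        exfalso
        have hGω : ∀ u, (H.deleteEdges {s(α, x)}).Adj ω u ↔ H.Adj ω u :=
          fun u => deleteEdges_base_adj R.ne hωx
        rcases exists_walk_or_bridge hpath' hxQ hω' k1 k10 R.ne' with ⟨r, hr⟩ | ⟨hαB, hωB⟩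
        · have hd2 : ∀ z, H.Adj ω' z → z ≠ α → H.degree z ≠ 2 := by
            intro z hz hzα hzd
            have := R.adj_two ω' z hz R.ne' hzα hω' hzd
            have hzω : z = ω := by grind
            have := hNω ω' (hzω ▸ hz.symm)
            grind
          by_cases k0xb : z₀ = x ∨ z₀ = b
          · by_cases k1xb : z₁ = x ∨ z₁ = b
            · obtain ⟨hz0, -⟩ := hshort' z₀ k₀.symm k0xb
              have hz1 : z₁ = x := k1xb.resolve_right fun h => k10 (h.trans hz0.symm)
              exact hboth ⟨hz1 ▸ k1, hz0 ▸ k₀.symm⟩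
            · push Not at k1xb
              exact hne (eq_of_detected hov.symm ((detected_next R hpath' R.ne' hx hxQ k1 k1P r hr
                (hspecial _ k1α k1xb.1 k1xb.2 (hd2 _ k1 k1α))).mono (List.prefix_append _ _))
                (hlen2.trans hlen')).symm
          · push Not at k0xb
            exact hne (eq_of_detected hov.symm (detected_of_penultimate R hpath' R.ne' hx hxQ k1 k10
              k1α r hr (hspecial _ k0α k0xb.1 k0xb.2 (hd2 _ k₀.symm k0α)))
              (hlen2.trans hlen')).symm
        -- A branch at `ω'` without `α` contains `ω`, by `conn` or through `x`, hence also `b`, and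
        -- then `α` after all.
        · refine hαB (base_mem_branch hb hxb.symm R.ne' ?_)
          have hωmem : ω ∈ branch (H.deleteEdges {s(α, x)}) ω' z₁ := by
            by_cases hxB : x ∈ branch (H.deleteEdges {s(α, x)}) ω' z₁
            · exact mem_branch_of_adj hxB ((hGω x).2 (h1x ▸ h1)).symm (Or.inl hne)
            · exact mem_branch_of_conn R k1.ne' hαB hxB
          exact mem_branch_of_adj hωmem ((hGω b).2 (h0b ▸ h₀.symm)) (Or.inl hωb'.symm)
      · push Not at h1xb
        exact (hfin (detected_next R hpath R.ne hx hxP h1 h1P q hq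
          (hspecial y₁ h1α h1xb.1 h1xb.2 h1d))).elim
  · exfalso
    -- If `ωy₁` is a bridge of `H - αx`, it separates `α` from `x`. So `y₁` separates them too, and
    -- `P` with the edge `ωy₁` is detected by means of a special edge found elsewhere.
    have hxB : x ∈ branch (H.deleteEdges {s(α, x)}) ω y₁ := by
      by_contra hxn
      exact hωB (mem_branch_of_conn R h1.ne' hαB hxn)
    obtain ⟨P₁, hP₁, hP₁s⟩ := exists_walk_deleteEdges _ hxP
    have hP₁path : P₁.IsPath := by
      rw [Walk.isPath_def, hP₁s]
      exact hpath.support_nodup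
    have hvα := hv.not_adj (by omega)
    have hvx : v ≠ x := fun h => hvα (h ▸ hx.symm)
    have hvω : v ≠ ω := by
      rintro rfl
      have := hv.2.1
      omega
    obtain ⟨w, y, hw, hwy, hwyP, hyα, hc⟩ := exists_special_edge_of_degree_two R hx hα hv P₁ hP₁path
      (by
        intro hvP c hc hcP hαv hvv hxv
        have hωv := support_disjoint_branch P₁ hcP hαv ω P₁.end_mem_support
        have hvB := support_disjoint_branch P₁ (hP₁ ▸ h1e) hαB v hvP
        obtain ⟨q, hq⟩ := exists_walk_of_mem_branch hxv
        have hcB : c ∉ branch (H.deleteEdges {s(α, x)}) ω y₁ := fun hcB =>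
          hvB (mem_branch_of_adj hcB ((deleteEdges_base_adj hv.1 hvx).2 hc).symm (Or.inl hvω))
        exact hωv (hq ω (mem_support_of_mem_branch q hcB hxB).1))
    have hne' : s(w, y) ≠ s(ω, y₁) := by
      intro h
      rw [h] at hc
      exact hωB (hc.preconnected y₁ ω)
    have := detected_of_separates hw hx hwy hyα hc ((P₀.concat h₀).concat h1)
      ((Walk.concat_isPath_iff h1).2 ⟨hpath, h1P⟩)
      (by
        rw [Walk.edges_concat _ h1, List.concat_eq_append, List.mem_append, not_or]
        refine ⟨hxP, ?_⟩
        have := R.ne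
        simp only [List.mem_singleton, Sym2.eq_iff]
        tauto)
      (by
        rw [Walk.edges_concat _ h1, List.concat_eq_append, List.mem_append, not_or]
        exact ⟨hP₁ ▸ hwyP, by simpa using hne'⟩)
      fun p => (mem_support_of_mem_branch p hαB hxB).2
    rw [Walk.edges_concat _ h1, List.concat_eq_append] at this
    exact hfin this

/-- This excludes that just one of `ω` and `ω'` is a neighbour of `α` when there are no special
vertices. Any vertex apart from `α`, `p`, `p'` is joined to both `p` and `p'`. As `p` has degree
two, `r` is the only such vertex; but then `p'` has degree two and is adjacent to `r`, contrary to
`hgen`. -/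
lemma false_of_adj_base {p p' r : W} (hα : ∀ z, H.Adj α z ↔ z = p ∨ z = p') (hpp : p' ≠ p)
    (h2 : ∀ u, 2 ≤ H.degree u) (hp : H.degree p = 2) (hrα : r ≠ α) (hrp : r ≠ p) (hrp' : r ≠ p')
    (hr : H.degree r = 2)
    (hgen : ∀ z u, H.Adj z u → z ≠ α → u ≠ α → H.degree z = 2 → H.degree u = 2 →
      (z = p ∨ u = p) ∧ (z = r ∨ u = r))
    (hd : ∀ z, z ≠ α → z ≠ p → z ≠ p' → H.degree z = 2) : False := by
  have hN : ∀ z, z ≠ α → z ≠ p → z ≠ p' → ∀ u, H.Adj z u → u = p ∨ u = p' := by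
    intro z hzα hzp hzp' u hzu
    have huα : u ≠ α := by
      rintro rfl
      have := (hα z).1 hzu.symm
      tauto
    by_contra hu
    push Not at hu
    have := hgen z u hzu hzα huα (hd z hzα hzp hzp') (hd u huα hu.1 hu.2)
    tauto
  have hNp : ∀ z, z ≠ α → z ≠ p → z ≠ p' → H.Adj z p ∧ H.Adj z p' := by
    intro z hzα hzp hzp'
    obtain ⟨u, hu, hzu⟩ := exists_adj_ne (h2 z) p
    obtain ⟨w, hw, hzw⟩ := exists_adj_ne (h2 z) p'
    have h1 := (hN z hzα hzp hzp' u hzu).resolve_left hu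
    have h2 := (hN z hzα hzp hzp' w hzw).resolve_right hw
    exact ⟨h2 ▸ hzw, h1 ▸ hzu⟩
  obtain ⟨hr1, hr2⟩ := hNp r hrα hrp hrp'
  have hαp := (hα p).2 (Or.inl rfl)
  have hαp' := (hα p').2 (Or.inr rfl)
  have hpN : ∀ z, H.Adj p z → z = α ∨ z = r := fun z hz =>
    eq_or_eq_of_degree_eq_two hp hαp.symm hr1.symm hrα.symm hz
  have hp' : 3 ≤ H.degree p' := by
    have h2p := h2 p'
    by_contra hlt
    have := hgen r p' hr2 hrα hαp'.ne' hr (by omega)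
    tauto
  obtain ⟨z, hzα, hzr, hz⟩ := exists_adj_ne_ne hp' α r
  have hzp : z ≠ p := by
    rintro rfl
    have := hpN p' hz.symm
    have := hαp'.ne
    grind
  have := hpN z (hNp z hzα hzp hz.ne').1.symm
  tauto

/-- If there are no special vertices and `α` has degree two, then there are so few possibilities
for `H` that `ω` and `ω'` are equivalent. -/
lemma exists_iso_of_no_special (R : Reduced H α ω ω') (hne : ω ≠ ω') (hdα : H.degree α = 2)
    (hno : ∀ v, ¬ IsSpecialVertex H α v) : ∃ σ : H ≃g H, σ α = α ∧ σ ω = ω' := by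
  obtain ⟨x, -, hx⟩ := exists_adj_ne hdα.ge α
  obtain ⟨x', hxx, hx'⟩ := exists_adj_ne hdα.ge x
  have hα : ∀ z, H.Adj α z ↔ z = x ∨ z = x' := fun z =>
    ⟨fun h => eq_or_eq_of_degree_eq_two hdα hx hx' hxx.symm h, by rintro (rfl | rfl) <;> assumption⟩
  have hα' : ∀ z, H.Adj α z ↔ z = x' ∨ z = x := fun z => (hα z).trans or_comm
  have hd : ∀ z, z ≠ α → z ≠ x → z ≠ x' → H.degree z = 2 := by
    intro z hzα hzx hzx'
    by_contra h2
    have := R.two_le z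
    refine hno z ⟨hzα, by omega, fun h => ?_⟩
    have := (hα z).1 h.symm
    tauto
  have hd' : ∀ z, z ≠ α → z ≠ x' → z ≠ x → H.degree z = 2 := fun z h1 h2 h3 => hd z h1 h3 h2
  have hgen' : ∀ z u, H.Adj z u → z ≠ α → u ≠ α → H.degree z = 2 → H.degree u = 2 →
      (z = ω' ∨ u = ω') ∧ (z = ω ∨ u = ω) :=
    fun z u h h1 h2 h3 h4 => (R.adj_two z u h h1 h2 h3 h4).symm
  have hN : ∀ z, z ≠ α → z ≠ x → z ≠ x' → ∀ u, H.Adj z u → u = x ∨ u = x' ∨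
      ((z = ω ∨ u = ω) ∧ (z = ω' ∨ u = ω')) := by
    intro z hzα hzx hzx' u hzu
    have huα : u ≠ α := by
      rintro rfl
      have := (hα z).1 hzu.symm
      tauto
    by_contra hu
    push Not at hu
    have := R.adj_two z u hzu hzα huα (hd z hzα hzx hzx') (hd u huα hu.1 hu.2.1)
    tauto
  -- All vertices other than `α`, `x`, `x'`, `ω`, `ω'` are joined exactly to `x` and `x'`.
  have hgeneric : ∀ z, z ≠ α → z ≠ x → z ≠ x' → z ≠ ω → z ≠ ω' → ∀ u,
      H.Adj z u ↔ u = x ∨ u = x' := by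
    intro z hzα hzx hzx' hzω hzω'
    have hN' : ∀ u, H.Adj z u → u = x ∨ u = x' := by
      intro u hu
      have := hN z hzα hzx hzx' u hu
      grind
    obtain ⟨u, hu, hzu⟩ := exists_adj_ne (R.two_le z) x
    obtain ⟨w, hw, hzw⟩ := exists_adj_ne (R.two_le z) x'
    have h1 := (hN' u hzu).resolve_left hu
    have h2 := (hN' w hzw).resolve_right hw
    subst h1 h2
    exact fun u => ⟨hN' u, by rintro (rfl | rfl) <;> assumption⟩
  have hωd := R.degree_eq
  have hRne := R.ne
  have hRne' := R.ne'
  by_cases hω : ω = x ∨ ω = x'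
  · by_cases hω' : ω' = x ∨ ω' = x'
    · refine exists_iso_swap R.ne R.ne' fun z hz hz' => ?_
      by_cases hzα : z = α
      · subst hzα
        rw [H.adj_comm ω, H.adj_comm ω', hα, hα]
        tauto
      · rw [H.adj_comm ω, H.adj_comm ω', hgeneric z hzα (by grind) (by grind) hz hz',
          hgeneric z hzα (by grind) (by grind) hz hz']
        tauto
    · exfalso
      push Not at hω'
      have hω'2 := hd ω' R.ne' hω'.1 hω'.2
      rcases hω with rfl | rfl
      · exact false_of_adj_base hα hxx R.two_le (hωd ▸ hω'2) R.ne' hω'.1 hω'.2 hω'2 R.adj_two hd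
      · exact false_of_adj_base hα' hxx.symm R.two_le (hωd ▸ hω'2) R.ne' hω'.2 hω'.1 hω'2 R.adj_two
          hd'
  · push Not at hω
    have hω2 := hd ω R.ne hω.1 hω.2
    have hω'2 := hωd.trans hω2
    by_cases hω' : ω' = x ∨ ω' = x'
    · exfalso
      rcases hω' with rfl | rfl
      · exact false_of_adj_base hα hxx R.two_le hω'2 R.ne hω.1 hω.2 hω2 hgen' hd
      · exact false_of_adj_base hα' hxx.symm R.two_le hω'2 R.ne hω.2 hω.1 hω2 hgen' hd'
    push Not at hω'
    have hNω := hN ω R.ne hω.1 hω.2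
    have hNω' := hN ω' R.ne' hω'.1 hω'.2
    by_cases hadj : H.Adj ω ω'
    · obtain ⟨p, hp, hωp⟩ := exists_adj_ne (R.two_le ω) ω'
      obtain ⟨q, hq, hωq⟩ := exists_adj_ne (R.two_le ω') ω
      have hA : ∀ z, H.Adj ω z ↔ z = ω' ∨ z = p := fun z =>
        ⟨fun h => eq_or_eq_of_degree_eq_two hω2 hadj hωp hp.symm h,
          by rintro (rfl | rfl) <;> assumption⟩
      have hA' : ∀ z, H.Adj ω' z ↔ z = ω ∨ z = q := fun z =>
        ⟨fun h => eq_or_eq_of_degree_eq_two hω'2 hadj.symm hωq hq.symm h,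
          by rintro (rfl | rfl); exacts [hadj.symm, hωq]⟩
      have hp' : p = x ∨ p = x' := by
        have := hNω p hωp
        grind
      have hq' : q = x ∨ q = x' := by
        have := hNω' q hωq
        grind
      by_cases hpq : p = q
      · subst hpq
        refine exists_iso_swap R.ne R.ne' fun z hz hz' => ?_
        rw [hA, hA']
        tauto
      -- Here `ω` and `ω'` are adjacent and attached to different neighbours of `α`, so both pairs
      -- must be exchanged simultaneously.
      · let f : W → W := fun z => Equiv.swap x x' (Equiv.swap ω ω' z)
        have fx : f x = x' := by
          simp [f, Equiv.swap_apply_of_ne_of_ne hω.1.symm hω'.1.symm]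
        have fx' : f x' = x := by
          simp [f, Equiv.swap_apply_of_ne_of_ne hω.2.symm hω'.2.symm]
        have fω : f ω = ω' := by
          simp [f, Equiv.swap_apply_of_ne_of_ne hω'.1 hω'.2]
        have fω' : f ω' = ω := by
          simp [f, Equiv.swap_apply_of_ne_of_ne hω.1 hω.2]
        have fz : ∀ z, z ≠ x → z ≠ x' → z ≠ ω → z ≠ ω' → f z = z := by
          intro z h1 h2 h3 h4
          simp [f, Equiv.swap_apply_of_ne_of_ne h1 h2, Equiv.swap_apply_of_ne_of_ne h3 h4]
        have hinv : Function.Involutive f := by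
          intro z
          by_cases z = x <;> by_cases z = x' <;> by_cases z = ω <;> by_cases z = ω' <;> grind
        have fα : f α = α := fz α hx.ne hx'.ne hRne.symm hRne'.symm
        have hmain : ∀ a b, H.Adj a b → (a ≠ x ∧ a ≠ x') → H.Adj (f a) (f b) := by
          intro a b hab ha
          by_cases haω : a = ω
          · subst haω
            rw [fω, hA']
            rcases (hA b).1 hab with rfl | rfl
            · exact Or.inl fω'
            · grind
          by_cases haω' : a = ω'
          · subst haω'
            rw [fω', hA]
            rcases (hA' b).1 hab with rfl | rfl
            · exact Or.inl fω
            · grind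
          rw [fz a ha.1 ha.2 haω haω']
          by_cases haα : a = α
          · subst haα
            rw [hα]
            have := (hα b).1 hab
            grind
          · rw [hgeneric a haα ha.1 ha.2 haω haω']
            have := (hgeneric a haα ha.1 ha.2 haω haω' b).1 hab
            grind
        refine ⟨isoOfInvolutive f hinv fun a b hab => ?_, fα, fω⟩
        by_cases ha : a ≠ x ∧ a ≠ x'
        · exact hmain a b hab ha
        by_cases hb : b ≠ x ∧ b ≠ x'
        · exact (hmain b a hab.symm hb).symm
        have := hab.ne
        have hxx'adj : (a = x ∧ b = x') ∨ (a = x' ∧ b = x) := by grind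
        rcases hxx'adj with ⟨rfl, rfl⟩ | ⟨rfl, rfl⟩
        · rw [fx, fx']
          exact hab.symm
        · rw [fx, fx']
          exact hab.symm
    · have key : ∀ z, z ≠ α → z ≠ x → z ≠ x' → (∀ u, H.Adj z u → u = x ∨ u = x') → ∀ u,
          H.Adj z u ↔ u = x ∨ u = x' := by
        intro z hzα hzx hzx' hN'
        obtain ⟨u, hu, hzu⟩ := exists_adj_ne (R.two_le z) x
        obtain ⟨w, hw, hzw⟩ := exists_adj_ne (R.two_le z) x'
        have h1 := (hN' u hzu).resolve_left hu
        have h2 := (hN' w hzw).resolve_right hw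
        subst h1 h2
        exact fun u => ⟨hN' u, by rintro (rfl | rfl) <;> assumption⟩
      have k1 := key ω R.ne hω.1 hω.2 (by
        intro u hu
        have := hNω u hu
        grind)
      have k2 := key ω' R.ne' hω'.1 hω'.2 (by
        intro u hu
        have := hNω' u hu
        have := hu.symm
        grind)
      exact exists_iso_swap R.ne R.ne' fun z _ _ => (k1 z).trans (k2 z).symm

/-- The end of a geodesic is determined, up to automorphisms of the reduced card, by the overlaps
of the geodesic with the closed walks that come from special spanning trees. -/
theorem exists_iso_of_overlapsAgree (R : Reduced H α ω ω') {P : H.Walk α ω} {P' : H.Walk α ω'}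
    (hP : P.length = H.dist α ω) (hP' : P'.length = H.dist α ω')
    (hov : OverlapsAgree H α P.edges P'.edges) : ∃ σ : H ≃g H, σ α = α ∧ σ ω = ω' := by
  by_cases hne : ω = ω'
  · exact ⟨Iso.refl, rfl, hne⟩
  by_cases hs : IsSpecialVertex H α ω
  · exact absurd (eq_of_special R hP hP' R.ne' hov hs R.degree_eq) hne
  by_cases hs' : IsSpecialVertex H α ω'
  · exact absurd (eq_of_special R hP' hP R.ne hov.symm hs' R.degree_eq.symm).symm hne
  have hω := R.two_le ω
  have hω' := R.two_le ω'
  have hdα := R.two_le α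
  have heq := R.degree_eq
  by_cases h3 : 3 ≤ H.degree α
  · refine absurd (eq_of_degree_two_of_three_le R hP hP' hov h3 ?_) hne
    by_contra h2
    exact hs ⟨R.ne, by omega, fun _ => h3⟩
  replace hdα : H.degree α = 2 := by omega
  by_cases hv : ∃ v, IsSpecialVertex H α v
  swap
  · push Not at hv
    exact exists_iso_of_no_special R hne hdα hv
  obtain ⟨v, hv⟩ := hv
  have hdeg : ∀ z, z ≠ α → ¬ IsSpecialVertex H α z → ¬ H.Adj z α → H.degree z = 2 := by
    intro z hz hzs hza
    have := R.two_le z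
    by_contra h2
    exact hzs ⟨hz, by omega, fun h => absurd h hza⟩
  have hpath := P.isPath_of_length_eq_dist hP
  have hpath' := P'.isPath_of_length_eq_dist hP'
  by_cases ha : H.Adj ω α
  · by_cases ha' : H.Adj ω' α
    · refine absurd ?_ hne
      have h1 := length_eq_one_of_adj hP ha
      have h1' := length_eq_one_of_adj hP' ha'
      obtain ⟨b, hb, Q, rfl⟩ := exists_eq_cons P R.ne.symm
      obtain ⟨b', hb', Q', rfl⟩ := exists_eq_cons P' R.ne'.symm
      have hbb := first_eq R hdα hv hov
      rw [← Walk.eq_of_length_eq_zero (p := Q) (by simpa using h1),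
        ← Walk.eq_of_length_eq_zero (p := Q') (by simpa using h1'), hbb]
    · have := hdeg ω' R.ne' hs' ha'
      exact absurd (eq_of_adj_degree_two R (length_eq_one_of_adj hP ha) R.ne hpath' R.ne' hov hdα
        (by omega) hv) hne
  · have h2 := hdeg ω R.ne hs ha
    by_cases ha' : H.Adj ω' α
    · exact absurd (eq_of_adj_degree_two R (length_eq_one_of_adj hP' ha') R.ne' hpath R.ne hov.symm
        hdα (by omega) hv).symm hne
    · exact exists_iso_of_degree_two R hne hP hP' hov hdα h2 ha ha' hv

end EdgeRecon

/-! ### The sum of the squared degrees is determined by the deck -/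

namespace EdgeRecon

open SimpleGraph Classical

section Deck

variable {V V' : Type*}

/-- An isomorphism restricts to edge-deleted subgraphs. -/
def deleteEdgesIso {G : SimpleGraph V} {G' : SimpleGraph V'} (φ : G ≃g G') (e : G.edgeSet) :
    G.deleteEdges {e.1} ≃g G'.deleteEdges {(φ.mapEdgeSet e).1} where
  toEquiv := φ.toEquiv
  map_rel_iff' := by
    intro u w
    have h1 : (φ.mapEdgeSet e).1 = Sym2.map φ e.1 := rfl
    have h2 : s(φ u, φ w) = Sym2.map φ s(u, w) := rfl
    rw [deleteEdges_adj, deleteEdges_adj]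
    simp only [Set.mem_singleton_iff, h1]
    change G'.Adj (φ u) (φ w) ∧ ¬ s(φ u, φ w) = _ ↔ _
    rw [h2, (Sym2.map.injective φ.injective).eq_iff, φ.map_adj_iff]

lemma SameEdgeDeck.refl (G : SimpleGraph V) : SameEdgeDeck G G :=
  ⟨Equiv.refl _, fun _ => ⟨Iso.refl⟩⟩

lemma SameEdgeDeck.trans_iso {V'' : Type*} {G : SimpleGraph V} {G' : SimpleGraph V'}
    {G'' : SimpleGraph V''} (h : SameEdgeDeck G G') (φ : G' ≃g G'') : SameEdgeDeck G G'' := by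
  obtain ⟨f, hf⟩ := h
  refine ⟨f.trans φ.mapEdgeSet, fun e => ?_⟩
  obtain ⟨ψ⟩ := hf e
  exact ⟨ψ.trans (deleteEdgesIso φ (f e))⟩

variable [Fintype V] [Fintype V']

lemma degree_iso {G : SimpleGraph V} {G' : SimpleGraph V'} (φ : G ≃g G') (x : V) :
    G'.degree (φ x) = G.degree x := by
  rw [← card_neighborSet_eq_degree, ← card_neighborSet_eq_degree]
  exact (Fintype.card_congr (φ.mapNeighborSet x)).symm

lemma degree_deleteEdges {G K : SimpleGraph V} {e : Sym2 V} (hK : K = G.deleteEdges {e})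
    (he : e ∈ G.edgeSet) (x : V) :
    K.degree x + (if x ∈ e then 1 else 0) = G.degree x := by
  have hadj : ∀ u w, K.Adj u w ↔ G.Adj u w ∧ s(u, w) ≠ e := by
    intro u w
    rw [hK, deleteEdges_adj, Set.mem_singleton_iff]
  split_ifs with hx
  · obtain ⟨y, rfl⟩ := hx
    have : K.neighborFinset x = (G.neighborFinset x).erase y := by
      ext z
      simp only [mem_neighborFinset, hadj, Finset.mem_erase, ne_eq, Sym2.congr_right]
      tauto
    rw [← card_neighborFinset_eq_degree, this, Finset.card_erase_add_one (by simpa using he),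
      card_neighborFinset_eq_degree]
  · rw [add_zero, ← card_neighborFinset_eq_degree, ← card_neighborFinset_eq_degree]
    congr 1
    ext z
    simp only [mem_neighborFinset, hadj, and_iff_left_iff_imp]
    rintro - rfl
    exact hx (by simp)

/-- The sum of the squares of the degrees. -/
noncomputable def degreeSquareSum (G : SimpleGraph V) : ℤ := ∑ x, (G.degree x : ℤ) ^ 2

lemma degreeSquareSum_iso {G : SimpleGraph V} {G' : SimpleGraph V'} (φ : G ≃g G') :
    degreeSquareSum G = degreeSquareSum G' :=
  Fintype.sum_equiv φ.toEquiv _ _ fun x => by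
    have := degree_iso φ x
    change _ = ((G'.degree (φ x) : ℕ) : ℤ) ^ 2
    rw [this]

/-- A vertex of degree `d` contributes `d ^ 2` for every edge, and `1 - 2 * d` in addition for each
of the `d` edges at it. Summation over the vertices uses the handshake lemma. -/
lemma sum_degreeSquareSum_deleteEdges (G : SimpleGraph V) (K : G.edgeSet → SimpleGraph V)
    (hK : ∀ e, K e = G.deleteEdges {e.1}) :
    ∑ e : G.edgeSet, degreeSquareSum (K e) =
      ((Fintype.card G.edgeSet : ℤ) - 2) * degreeSquareSum G + 2 * Fintype.card G.edgeSet := by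
  have h1 : ∀ x, ∑ e : G.edgeSet, (((K e).degree x : ℕ) : ℤ) ^ 2 =
      (Fintype.card G.edgeSet : ℤ) * (G.degree x : ℤ) ^ 2 +
        (G.degree x : ℤ) * (1 - 2 * (G.degree x : ℤ)) := by
    intro x
    have h2 : ∀ e : G.edgeSet, (((K e).degree x : ℕ) : ℤ) ^ 2 =
        (G.degree x : ℤ) ^ 2 + if x ∈ e.1 then (1 - 2 * (G.degree x : ℤ)) else 0 := by
      intro e
      have h3 := degree_deleteEdges (hK e) e.2 x
      have h4 : (((K e).degree x : ℕ) : ℤ) =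
          (G.degree x : ℤ) - if x ∈ e.1 then 1 else 0 := by
        rw [← h3]
        push_cast
        ring
      rw [h4]
      split_ifs <;> ring
    rw [Finset.sum_congr rfl fun e _ => h2 e, Finset.sum_add_distrib, Finset.sum_const,
      Finset.card_univ, nsmul_eq_mul, ← Finset.sum_filter, Finset.sum_const, nsmul_eq_mul]
    congr 2
    norm_cast
    rw [← card_incidenceFinset_eq_degree]
    refine Finset.card_bij (fun e _ => e.1) ?_ ?_ ?_
    · intro e he
      simp only [Finset.mem_filter, Finset.mem_univ, true_and] at he
      simpa [mem_incidenceFinset, incidenceSet] using he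
    · intro e _ e' _ h
      exact Subtype.ext h
    · intro e he
      rw [mem_incidenceFinset] at he
      exact ⟨⟨e, he.1⟩, by simpa using he.2, rfl⟩
  have h5 : ∑ x, (G.degree x : ℤ) = 2 * Fintype.card G.edgeSet := by
    have := G.sum_degrees_eq_twice_card_edges
    rw [← edgeFinset_card]
    exact_mod_cast this
  unfold degreeSquareSum
  rw [Finset.sum_comm, Finset.sum_congr rfl fun x _ => h1 x, Finset.sum_add_distrib,
    ← Finset.mul_sum, ← h5]
  have h6 : ∀ x, (G.degree x : ℤ) * (1 - 2 * (G.degree x : ℤ)) =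
      (G.degree x : ℤ) - 2 * (G.degree x : ℤ) ^ 2 := fun x => by ring
  rw [Finset.sum_congr rfl fun x _ => h6 x, Finset.sum_sub_distrib, ← Finset.mul_sum]
  ring

lemma SameEdgeDeck.card_eq {G : SimpleGraph V} {G' : SimpleGraph V'} (h : SameEdgeDeck G G') :
    Fintype.card G.edgeSet = Fintype.card G'.edgeSet :=
  Fintype.card_congr h.choose

/-- The edge deck determines the sum of the squares of the degrees. -/
lemma SameEdgeDeck.degreeSquareSum_eq {G : SimpleGraph V} {G' : SimpleGraph V'}
    (h : SameEdgeDeck G G') (hm : 2 < Fintype.card G.edgeSet) :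
    degreeSquareSum G = degreeSquareSum G' := by
  have hc := h.card_eq
  obtain ⟨f, hf⟩ := h
  have h1 : ∑ e : G.edgeSet, degreeSquareSum (G.deleteEdges {e.1}) =
      ∑ e : G'.edgeSet, degreeSquareSum (G'.deleteEdges {e.1}) :=
    Fintype.sum_equiv f _ _ fun e => degreeSquareSum_iso (hf e).some
  rw [sum_degreeSquareSum_deleteEdges G _ fun _ => rfl,
    sum_degreeSquareSum_deleteEdges G' _ fun _ => rfl, ← hc] at h1
  have h2 : ((Fintype.card G.edgeSet : ℤ) - 2) ≠ 0 := by
    have : (2 : ℤ) < Fintype.card G.edgeSet := by exact_mod_cast hm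
    omega
  exact mul_left_cancel₀ h2 (add_right_cancel h1)

/-- A new edge adds `2 * d + 1` at each end. With `K` and `a` fixed, the sum therefore reveals the
degree of the other end. -/
lemma degreeSquareSum_deleteEdges {G K : SimpleGraph V} {a ω : V}
    (hK : K = G.deleteEdges {s(a, ω)}) (h : G.Adj a ω) :
    degreeSquareSum G =
      degreeSquareSum K + (2 * (K.degree a : ℤ) + 1) + (2 * (K.degree ω : ℤ) + 1) := by
  have h1 : ∀ x, (G.degree x : ℤ) ^ 2 = (K.degree x : ℤ) ^ 2 +
      ((if x = a then 2 * (K.degree x : ℤ) + 1 else 0) +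
        if x = ω then 2 * (K.degree x : ℤ) + 1 else 0) := by
    intro x
    have h3 := degree_deleteEdges hK h x
    have hne := h.ne
    by_cases hxa : x = a
    · subst hxa
      simp only [Sym2.mem_iff, true_or, if_true] at h3
      rw [← h3, if_pos rfl, if_neg hne]
      push_cast
      ring
    · by_cases hxω : x = ω
      · subst hxω
        simp only [Sym2.mem_iff, or_true, if_true] at h3
        rw [← h3, if_pos rfl, if_neg hxa]
        push_cast
        ring
      · simp only [Sym2.mem_iff, hxa, hxω, or_self, if_false] at h3
        rw [← h3]
        simp [hxa, hxω]
  unfold degreeSquareSum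
  rw [Finset.sum_congr rfl fun x _ => h1 x, Finset.sum_add_distrib, Finset.sum_add_distrib,
    Finset.sum_ite_eq' Finset.univ a, Finset.sum_ite_eq' Finset.univ ω]
  simp only [Finset.mem_univ, if_true]
  ring

end Deck

end EdgeRecon

/-! ### Minimal degree, completions of a card, and the reduced card -/

namespace EdgeRecon

open SimpleGraph Classical

section DeckDegrees

variable {V V' : Type*}

lemma two_le_degree {W : Type*} [Fintype W] {H : SimpleGraph W} {u a b : W} (ha : H.Adj u a)
    (hb : H.Adj u b) (hab : a ≠ b) : 2 ≤ H.degree u := by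
  rw [← card_neighborFinset_eq_degree, ← Finset.card_pair hab]
  apply Finset.card_le_card
  intro z
  simp only [Finset.mem_insert, Finset.mem_singleton, mem_neighborFinset]
  rintro (rfl | rfl) <;> assumption

lemma Standing.eq_of_degree {V : Type u} [Fintype V] {G K : SimpleGraph V} (hG : Standing G)
    {e : Sym2 V} (he : e ∈ G.edgeSet) (hK : K = G.deleteEdges {e}) {x y : V}
    (hx : K.degree x + 1 = G.minDegree) (hy : K.degree y + 1 = G.minDegree) : x = y := by
  subst hK
  refine hG.card_degree e he ?_ ?_ <;> rw [Set.mem_ofPred_eq]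
  · convert! hx
  · convert! hy

/-- All cards have degrees at least `δ - 1`, which is positive, so `x` has an edge; the card without
this edge shows that `x` itself has degree at least `δ`. -/
lemma Standing.minDegree_le {V : Type u} {V' : Type*} [Fintype V] [Fintype V'] {G : SimpleGraph V}
    {G' : SimpleGraph V'} (hG : Standing G) (h : SameEdgeDeck G G') (x : V') :
    G.minDegree ≤ G'.degree x := by
  obtain ⟨f, hf⟩ := h
  have h1 : ∀ (e' : G'.edgeSet) (K : SimpleGraph V'), K = G'.deleteEdges {e'.1} →
      G.minDegree ≤ K.degree x + 1 := by
    rintro e' K rfl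
    obtain ⟨e, rfl⟩ := f.surjective e'
    obtain ⟨φ⟩ := hf e
    have h2 := degree_iso φ (φ.symm x)
    rw [φ.apply_symm_apply] at h2
    have h3 := degree_deleteEdges (G := G) rfl e.2 (φ.symm x)
    have h4 := G.minDegree_le_degree (φ.symm x)
    rw [← h3] at h4
    split_ifs at h4 <;> omega
  have h2 := hG.two_le_minDegree
  obtain ⟨v, hv⟩ : ∃ v, G.degree v = G.minDegree := by
    have := hG.connected.nonempty
    obtain ⟨w, hw⟩ := G.exists_minimal_degree_vertex
    exact ⟨w, hw.symm⟩
  obtain ⟨w, -, hw⟩ := exists_adj_ne (hv ▸ h2 : 2 ≤ G.degree v) v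
  have h3 := h1 (f ⟨s(v, w), hw⟩) _ rfl
  have h4 := degree_deleteEdges (K := G'.deleteEdges {(f ⟨s(v, w), hw⟩).1}) rfl (f ⟨s(v, w), hw⟩).2 x
  obtain ⟨y, hy⟩ : ∃ y, G'.Adj x y := by
    have : 0 < G'.degree x := by omega
    rwa [degree_pos_iff_exists_adj] at this
  have h5 := h1 ⟨s(x, y), hy⟩ _ rfl
  have h6 := degree_deleteEdges (K := G'.deleteEdges {s(x, y)}) rfl hy x
  simp only [Sym2.mem_iff, true_or, if_true] at h6
  exact h6 ▸ h5

/-- Removing an edge between two vertices of degree `δ` would give a card with two vertices of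
degree `δ - 1`, but it is also a card of `G`. -/
lemma Standing.not_adj_of_degree {V : Type u} {V' : Type*} [Fintype V] [Fintype V']
    {G : SimpleGraph V} {G' : SimpleGraph V'} (hG : Standing G) (h : SameEdgeDeck G G') {u w : V'}
    (huw : G'.Adj u w) (hu : G'.degree u = G.minDegree) : G'.degree w ≠ G.minDegree := by
  intro hw
  obtain ⟨f, hf⟩ := h
  obtain ⟨e, he⟩ := f.surjective ⟨s(u, w), huw⟩
  obtain ⟨φ⟩ := hf e
  obtain ⟨K, hK⟩ : ∃ K, K = G.deleteEdges {e.1} := ⟨_, rfl⟩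
  obtain ⟨K', hK'⟩ : ∃ K', K' = G'.deleteEdges {(f e).1} := ⟨_, rfl⟩
  rw [← hK, ← hK'] at φ
  have h1 : ∀ x, x ∈ s(u, w) → G'.degree x = G.minDegree →
      K.degree (φ.symm x) + 1 = G.minDegree := by
    intro x hx hd
    have h3 := degree_deleteEdges hK' (f e).2 x
    rw [he, if_pos hx, hd] at h3
    rw [degree_iso φ.symm x, h3]
  exact huw.ne (φ.symm.injective (hG.eq_of_degree e.2 hK (h1 u (by simp) hu) (h1 w (by simp) hw)))

end DeckDegrees

variable {V : Type u} [Fintype V] {K G G' : SimpleGraph V} {a ω ω' : V} {δ : ℕ}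

/-- `G` arises from `K` by adding the edge `aω`, has minimal degree `δ`, and no two vertices of
degree `δ` are adjacent in `G`; in `K`, only `a` has a smaller degree. -/
structure IsCompletion (K : SimpleGraph V) (a : V) (δ : ℕ) (G : SimpleGraph V) (ω : V) : Prop where
  adj : G.Adj a ω
  eq : K = G.deleteEdges {s(a, ω)}
  two_le : 2 ≤ δ
  degree_base : K.degree a + 1 = δ
  le_degree : ∀ x, x ≠ a → δ ≤ K.degree x
  indep : ∀ u w, G.Adj u w → G.degree u = δ → G.degree w ≠ δ

namespace IsCompletion

lemma adj_iff (h : IsCompletion K a δ G ω) (u w : V) :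
    G.Adj u w ↔ K.Adj u w ∨ (u = a ∧ w = ω) ∨ (u = ω ∧ w = a) := by
  rw [h.eq, deleteEdges_adj]
  simp only [Set.mem_singleton_iff, Sym2.eq_iff]
  have h1 := h.adj
  have h2 := h.adj.symm
  constructor
  · tauto
  · rintro (h | ⟨rfl, rfl⟩ | ⟨rfl, rfl⟩)
    exacts [h.1, h1, h2]

lemma not_adj (h : IsCompletion K a δ G ω) : ¬ K.Adj a ω := by
  rw [h.eq, deleteEdges_adj]
  simp

lemma le (h : IsCompletion K a δ G ω) : K ≤ G := h.eq ▸ deleteEdges_le _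

lemma degree_of_ne (h : IsCompletion K a δ G ω) {x : V} (hx : x ≠ a) (hxω : x ≠ ω) :
    G.degree x = K.degree x := by
  have := degree_deleteEdges h.eq h.adj x
  simp only [Sym2.mem_iff, hx, hxω, or_self, if_false] at this
  exact this.symm

lemma degree_left (h : IsCompletion K a δ G ω) : G.degree a = δ := by
  have := degree_deleteEdges h.eq h.adj a
  simp only [Sym2.mem_iff, true_or, if_true] at this
  rw [← this, h.degree_base]

lemma ne_of_adj (h : IsCompletion K a δ G ω) {w : V} (hw : K.Adj a w) : K.degree w ≠ δ := by
  intro hd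
  have hwω : w ≠ ω := fun hwω => h.not_adj (hwω ▸ hw)
  exact h.indep a w (h.le hw) h.degree_left ((h.degree_of_ne hw.ne' hwω).trans hd)

lemma eq_of_adj (h : IsCompletion K a δ G ω) {u w : V} (huw : K.Adj u w) (hu : u ≠ a) (hw : w ≠ a)
    (hud : K.degree u = δ) (hwd : K.degree w = δ) : u = ω ∨ w = ω := by
  by_contra hcon
  push Not at hcon
  exact h.indep u w (h.le huw) ((h.degree_of_ne hu hcon.1).trans hud)
    ((h.degree_of_ne hw hcon.2).trans hwd)

lemma mem_coreVerts (h : IsCompletion K a δ G ω) : ω ∈ coreVerts K a := fun _ => h.adj.ne'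

end IsCompletion

lemma IsBase.eq_of_adj {α : coreVerts K a} (hα : IsBase K a α) (h1 : K.degree a = 1) {z : V}
    (hz : K.Adj a z) : z = α := by
  by_contra hne
  have := two_le_degree hz (hα.1 h1) hne
  omega

lemma notMem_coreVerts {z : V} (hz : z ∉ coreVerts K a) : K.degree a = 1 ∧ z = a := by
  simpa [coreVerts] using hz

lemma core_degree {x : coreVerts K a} (h : K.degree a = 1 → ¬ K.Adj a x) :
    (core K a).degree x = K.degree x := by
  rw [← card_neighborFinset_eq_degree, ← card_neighborFinset_eq_degree]
  refine Finset.card_bij (fun z _ => z.1) ?_ ?_ ?_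
  · intro z hz
    rw [mem_neighborFinset] at hz ⊢
    exact hz
  · intro z _ w _ hzw
    exact Subtype.ext hzw
  · intro z hz
    rw [mem_neighborFinset] at hz
    have hzc : z ∈ coreVerts K a := by
      rintro h1 rfl
      exact h h1 hz.symm
    exact ⟨⟨z, hzc⟩, by rw [mem_neighborFinset]; exact hz, rfl⟩

theorem reduced_core {α : coreVerts K a} (hα : IsBase K a α) (hK : K.Connected)
    (hcut : ∀ v : V, (G.induce {v}ᶜ).Preconnected) (h : IsCompletion K a δ G ω)
    (h' : IsCompletion K a δ G' ω') (hdeg : K.degree ω' = K.degree ω) :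
    Reduced (core K a) α ⟨ω, h.mem_coreVerts⟩ ⟨ω', h'.mem_coreVerts⟩ where
  connected := by
    rw [connected_iff_exists_forall_reachable]
    refine ⟨α, fun w => ?_⟩
    -- The component of `α` in the reduced card, together with the removed pendant vertex, is closed
    -- under adjacency in `K`.
    let S : Set V := {z | (∃ hz : z ∈ coreVerts K a, (core K a).Reachable α ⟨z, hz⟩) ∨
      z ∉ coreVerts K a}
    have hS : ∀ u ∈ S, ∀ w, K.Adj u w → w ∈ S := by
      intro u hu w huw
      by_cases hw : w ∈ coreVerts K a
      · left
        refine ⟨hw, ?_⟩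
        rcases hu with ⟨hu, hr⟩ | hu
        · exact hr.trans (Adj.reachable (G := core K a) (u := ⟨u, hu⟩) (v := ⟨w, hw⟩) huw)
        · obtain ⟨h1, rfl⟩ := notMem_coreVerts hu
          have := hα.eq_of_adj h1 huw
          subst this
          exact Reachable.refl _
      · exact Or.inr hw
    rcases mem_of_reachable hS (hK.preconnected α w) (Or.inl ⟨α.2, Reachable.refl _⟩) with
      ⟨_, hr⟩ | hw
    · exact hr
    · exact absurd w.2 hw
  two_le := by
    intro u
    by_cases hu : K.degree a = 1 ∧ K.Adj a u
    -- This vertex loses its pendant neighbour `a`. Here `δ = 2`, and a neighbour of `a` cannot have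
    -- degree `δ`.
    · have h3 : 3 ≤ K.degree u := by
        have h1 := h.ne_of_adj hu.2
        have h2 := h.le_degree u hu.2.ne'
        have := h.degree_base
        omega
      obtain ⟨z₁, hz₁, -, hz1⟩ := exists_adj_ne_ne h3 a a
      obtain ⟨z₂, hz₂, hz21, hz2⟩ := exists_adj_ne_ne h3 a z₁
      exact two_le_degree (H := core K a) (a := ⟨z₁, fun _ => hz₁⟩) (b := ⟨z₂, fun _ => hz₂⟩)
        hz1 hz2 fun hz => hz21 (congrArg Subtype.val hz).symm
    · rw [core_degree fun h1 h2 => hu ⟨h1, h2⟩]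
      have h2 := h.two_le
      have h3 := h.degree_base
      by_cases hua : u.1 = a
      · have h4 : K.degree a ≠ 1 := fun h1 => u.2 h1 hua
        rw [hua]
        omega
      · exact h2.trans (h.le_degree u hua)
  ne := by
    intro hωα
    have hωα : ω = α := congrArg Subtype.val hωα
    by_cases h1 : K.degree a = 1
    · exact h.not_adj (hωα ▸ hα.1 h1)
    · exact h.adj.ne (hωα.trans (hα.2 h1)).symm
  ne' := by
    intro hωα
    have hωα : ω' = α := congrArg Subtype.val hωα
    by_cases h1 : K.degree a = 1
    · exact h'.not_adj (hωα ▸ hα.1 h1)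
    · exact h'.adj.ne (hωα.trans (hα.2 h1)).symm
  degree_eq := by
    rw [core_degree (x := ⟨ω, h.mem_coreVerts⟩) fun _ => h.not_adj,
      core_degree (x := ⟨ω', h'.mem_coreVerts⟩) fun _ => h'.not_adj]
    exact hdeg
  adj_two := by
    intro u w huw hu hw hud hwd
    have hna : ∀ z : coreVerts K a, z ≠ α → K.degree a = 1 → ¬ K.Adj a z :=
      fun z hz h1 hadj => hz (Subtype.ext (hα.eq_of_adj h1 hadj))
    have hne : ∀ z : coreVerts K a, z ≠ α → z.1 ≠ a := by
      intro z hz hza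
      by_cases h1 : K.degree a = 1
      · exact z.2 h1 hza
      · exact hz (Subtype.ext (hza.trans (hα.2 h1).symm))
    rw [core_degree (hna u hu)] at hud
    rw [core_degree (hna w hw)] at hwd
    have h2 := h.two_le
    have h3 := h.le_degree u (hne u hu)
    have hδ : δ = 2 := by omega
    subst hδ
    have e1 := h.eq_of_adj huw (hne u hu) (hne w hw) hud hwd
    have e2 := h'.eq_of_adj huw (hne u hu) (hne w hw) hud hwd
    exact ⟨e1.imp (fun h => Subtype.ext h) (fun h => Subtype.ext h),
      e2.imp (fun h => Subtype.ext h) (fun h => Subtype.ext h)⟩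
  conn := by
    intro v u huv
    by_contra hcon
    push Not at hcon
    have hne : ∀ z : coreVerts K a, ((core K a).deleteIncidenceSet v).Reachable u z →
        z.1 ≠ α ∧ z.1 ≠ ω := by
      intro z hz
      constructor
      · intro h1
        have : z = α := Subtype.ext h1
        exact hcon.1 (this ▸ hz)
      · rintro rfl
        exact hcon.2 hz
    -- A component of `H - v` without `α` and `ω` has no further edges in `G - v`, since edges
    -- outside `H` meet it only at these two vertices. As `G - v` is connected, this is impossible.
    let S : Set ({v.1}ᶜ : Set V) := {z | ∃ hz : z.1 ∈ coreVerts K a,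
      ((core K a).deleteIncidenceSet v).Reachable u ⟨z, hz⟩}
    have hS : ∀ z ∈ S, ∀ y, (G.induce {v.1}ᶜ).Adj z y → y ∈ S := by
      rintro z ⟨hz, hr⟩ y hzy
      have hzy' : G.Adj z.1 y.1 := hzy
      rw [h.adj_iff] at hzy'
      have hz' := hne _ hr
      have hza : z.1 ≠ a := by
        intro hza
        by_cases h1 : K.degree a = 1
        · exact hz h1 hza
        · exact hz'.1 (hza.trans (hα.2 h1).symm)
      have hK' : K.Adj z y := by
        rcases hzy' with h1 | ⟨h1, -⟩ | ⟨h1, -⟩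
        · exact h1
        · exact absurd h1 hza
        · exact absurd h1 hz'.2
      have hy : y.1 ∈ coreVerts K a := by
        intro h1 hya
        have hadj : ∀ b, y.1 = b → K.Adj b z := fun b hb => hb ▸ hK'.symm
        exact hz'.1 (hα.eq_of_adj h1 (hadj a hya))
      refine ⟨hy, hr.trans (Adj.reachable ?_)⟩
      rw [deleteIncidenceSet_adj]
      exact ⟨hK', fun h1 => z.2 (congrArg Subtype.val h1), fun h1 => y.2 (congrArg Subtype.val h1)⟩
    have hu : (⟨u.1, fun h1 => huv (Subtype.ext h1)⟩ : ({v.1}ᶜ : Set V)) ∈ S :=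
      ⟨u.2, Reachable.refl _⟩
    by_cases hv : v = α
    · have hωv : ω ≠ v.1 := by
        rw [hv]
        intro hωα
        by_cases h1 : K.degree a = 1
        · exact h.not_adj (hωα ▸ hα.1 h1)
        · exact h.adj.ne (hωα.trans (hα.2 h1)).symm
      obtain ⟨hz, hr⟩ := mem_of_reachable hS (hcut v.1 _ ⟨ω, hωv⟩) hu
      exact (hne _ hr).2 rfl
    · obtain ⟨hz, hr⟩ := mem_of_reachable hS
        (hcut v.1 _ ⟨α.1, fun h1 => hv (Subtype.ext h1.symm)⟩) hu
      exact (hne _ hr).1 rfl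

end EdgeRecon

/-! ### Minimal loops and geodesics of the reduced card -/

namespace EdgeRecon

open SimpleGraph Classical

section Loops

lemma _root_.SimpleGraph.Walk.IsPath.fst_ne_of_mem_darts {V : Type*} {G : SimpleGraph V} {x y : V}
    {p : G.Walk x y} (hp : p.IsPath) {d : G.Dart} (hd : d ∈ p.darts) : d.fst ≠ y := by
  induction p with
  | nil => simp at hd
  | cons h p ih =>
    rw [Walk.cons_isPath_iff] at hp
    rw [Walk.darts_cons, List.mem_cons] at hd
    rcases hd with rfl | hd
    · rintro rfl
      exact hp.2 p.end_mem_support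
    · exact ih hp.1 hd

variable {V : Type u} [Fintype V] {K G : SimpleGraph V} {a ω : V} {δ : ℕ}

lemma exists_core_walk {x y : V} (p : G.Walk x y) (hp : ∀ e ∈ p.edges, e ∈ K.edgeSet)
    (hs : ∀ z ∈ p.support, z ∈ coreVerts K a) (hx : x ∈ coreVerts K a) (hy : y ∈ coreVerts K a) :
    ∃ P : (core K a).Walk ⟨x, hx⟩ ⟨y, hy⟩, P.edges.map (Sym2.map Subtype.val) = p.edges := by
  induction p with
  | nil => exact ⟨Walk.nil, rfl⟩
  | @cons x w y h p ih =>
    simp only [Walk.edges_cons, List.mem_cons, forall_eq_or_imp] at hp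
    simp only [Walk.support_cons, List.mem_cons, forall_eq_or_imp] at hs
    have hw := hs.2 w p.start_mem_support
    obtain ⟨P, hP⟩ := ih hp.2 hs.2 hw hy
    have hadj : (core K a).Adj ⟨x, hx⟩ ⟨w, hw⟩ := hp.1
    exact ⟨Walk.cons hadj P, by simp [hP]⟩

lemma map_mem_edgeSet {e' : Sym2 (coreVerts K a)} (he' : e' ∈ (core K a).edgeSet) :
    Sym2.map Subtype.val e' ∈ K.edgeSet ∧ (K.degree a = 1 → a ∉ Sym2.map Subtype.val e') := by
  induction e' with
  | h x y =>
    refine ⟨he', fun h1 => ?_⟩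
    simp only [Sym2.map_mk, Sym2.mem_iff, not_or]
    exact ⟨(x.2 h1).symm, (y.2 h1).symm⟩

lemma IsCompletion.mem_edgeSet (h : IsCompletion K a δ G ω) {e : Sym2 V} (he : e ∈ G.edgeSet)
    (hne : e ≠ s(a, ω)) : e ∈ K.edgeSet := by
  rw [h.eq, edgeSet_deleteEdges]
  exact ⟨he, hne⟩

/-- The loop begins with the edge from `a` to `ω`, preceded by that from `α` to `a` if `a` is
pendant in `K`. In the inverse loop these edges, which are not in the reduced card, come last. -/
lemma exists_walk_of_isLoopThrough {α : coreVerts K a} (hα : IsBase K a α)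
    (h : IsCompletion K a δ G ω) {γ : G.Walk (α : V) α} (hγ : IsLoopThrough a ω γ) :
    ∃ (P : (core K a).Walk α ⟨ω, h.mem_coreVerts⟩) (t : List (Sym2 V)),
      γ.reverse.edges = P.edges.map (Sym2.map Subtype.val) ++ t ∧
      t.length = (if K.degree a = 1 then 2 else 1) ∧
      ∀ e ∈ t, ∀ e' ∈ (core K a).edgeSet, e ≠ Sym2.map Subtype.val e' := by
  have key : ∀ (q : G.Walk ω α), (∀ e ∈ q.edges, e ∈ K.edgeSet) →
      (∀ z ∈ q.support, z ∈ coreVerts K a) →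
      ∃ P : (core K a).Walk α ⟨ω, h.mem_coreVerts⟩,
        P.edges.map (Sym2.map Subtype.val) = q.edges.reverse := by
    intro q hq hs
    obtain ⟨P, hP⟩ := exists_core_walk q hq hs h.mem_coreVerts α.2
    exact ⟨P.reverse, by rw [Walk.edges_reverse, List.map_reverse, hP]⟩
  have htail : ∀ e' ∈ (core K a).edgeSet, s(a, ω) ≠ Sym2.map Subtype.val e' := by
    intro e' he' heq
    exact h.not_adj (heq ▸ (map_mem_edgeSet he').1 : s(a, ω) ∈ K.edgeSet)
  obtain ⟨hc, d, hd, hda, hdω⟩ := hγ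
  by_cases h1 : K.degree a = 1
  · have hαa : (α : V) ≠ a := α.2 h1
    rw [if_pos h1]
    cases γ with
    | nil => exact absurd rfl hc.ne_nil
    | @cons _ u _ hu p =>
      rw [Walk.cons_isCycle_iff] at hc
      rw [Walk.darts_cons, List.mem_cons] at hd
      have hd : d ∈ p.darts := by
        rcases hd with rfl | hd
        · exact absurd hda hαa
        · exact hd
      have hmem : a ∈ p.support := hda ▸ p.dart_fst_mem_support_of_mem_darts hd
      obtain ⟨q, r, rfl⟩ := exists_append_of_mem_support p hmem
      obtain ⟨c, hac, r, rfl⟩ := exists_eq_cons r hαa.symm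
      have hr := hc.1.of_append_right
      rw [Walk.darts_append, List.mem_append, Walk.darts_cons, List.mem_cons] at hd
      rw [Walk.cons_isPath_iff] at hr
      obtain rfl : c = ω := by
        rcases hd with hd | rfl | hd
        · exact absurd hda (hc.1.of_append_left.fst_ne_of_mem_darts hd)
        · exact hdω
        · exact absurd (hda ▸ r.dart_fst_mem_support_of_mem_darts hd) hr.2
      -- The only neighbours of `a` in `G` are `α` and `ω`. Both occur after `a` on the path, so `a`
      -- can be preceded only by the start of the loop.
      obtain rfl : u = a := by
        by_contra hua
        obtain ⟨b, q, hb, rfl⟩ := exists_eq_concat q hua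
        have h2 := hc.1
        rw [Walk.concat_append] at h2
        have h3 := h2.of_append_right
        rw [Walk.cons_isPath_iff] at h3
        apply h3.2
        rw [Walk.support_cons, List.mem_cons]
        right
        rcases (h.adj_iff a b).1 hb.symm with h4 | ⟨-, rfl⟩ | ⟨h4, -⟩
        · rw [hα.eq_of_adj h1 h4]
          exact r.end_mem_support
        · exact r.start_mem_support
        · exact absurd h4 h.adj.ne
      obtain rfl : q = Walk.nil := by
        simpa using hc.1.of_append_left
      obtain ⟨P, hP⟩ := key r
        (fun e he => h.mem_edgeSet (r.edges_subset_edgeSet he) fun h2 =>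
          hr.2 (r.fst_mem_support_of_mem_edges (h2 ▸ he)))
        (fun z hz _ hza => hr.2 (hza ▸ hz))
      refine ⟨P, [s(u, c), s((α : V), u)], by simp [hP], rfl, ?_⟩
      intro e he e' he' heq
      refine (map_mem_edgeSet he').2 h1 (heq ▸ ?_)
      simp only [List.mem_cons, List.not_mem_nil, or_false] at he
      rcases he with rfl | rfl <;> simp
  · have hαa : (α : V) = a := hα.2 h1
    rw [if_neg h1]
    cases γ with
    | nil => exact absurd rfl hc.ne_nil
    | @cons _ u _ hu p =>
      rw [Walk.cons_isCycle_iff] at hc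
      rw [Walk.darts_cons, List.mem_cons] at hd
      obtain rfl : u = ω := by
        rcases hd with rfl | hd
        · exact hdω
        · exact absurd (hda.trans hαa.symm) (hc.1.fst_ne_of_mem_darts hd)
      obtain ⟨P, hP⟩ := key p
        (fun e he => h.mem_edgeSet (p.edges_subset_edgeSet he) fun h2 =>
          hc.2 ((congrArg (fun z => s(z, u)) hαa).trans h2.symm ▸ he))
        (fun z _ h2 => absurd h2 h1)
      refine ⟨P, [s(a, u)], by simp [hP, hαa], rfl, ?_⟩
      intro e he
      rw [List.mem_singleton.1 he]
      exact htail

lemma exists_isLoopThrough {α : coreVerts K a} (hα : IsBase K a α)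
    (h : IsCompletion K a δ G ω) {P : (core K a).Walk α ⟨ω, h.mem_coreVerts⟩} (hP : P.IsPath) :
    ∃ γ : G.Walk (α : V) α, IsLoopThrough a ω γ ∧
      γ.length = P.length + (if K.degree a = 1 then 2 else 1) := by
  let f : core K a →g G := (Hom.ofLE h.le).comp (Embedding.induce (coreVerts K a)).toHom
  have hf : Function.Injective f := Subtype.val_injective
  obtain ⟨q, hq, hl, hs, he⟩ : ∃ q : G.Walk ω α, q.IsPath ∧ q.length = P.length ∧
      (∀ z ∈ q.support, z ∈ coreVerts K a) ∧ s(a, ω) ∉ q.edges := by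
    obtain ⟨q, hq, hl, hs, he⟩ : ∃ q : G.Walk ω α, q.IsPath ∧ q.length = P.reverse.length ∧
        q.support = P.reverse.support.map Subtype.val ∧
        q.edges = P.reverse.edges.map (Sym2.map Subtype.val) :=
      ⟨P.reverse.map f, hP.reverse.map hf, Walk.length_map _ _, Walk.support_map _ _,
        Walk.edges_map _ _⟩
    refine ⟨q, hq, hl.trans (Walk.length_reverse _), ?_, ?_⟩
    · intro z hz
      rw [hs, List.mem_map] at hz
      obtain ⟨w, -, rfl⟩ := hz
      exact w.2
    · intro h2
      rw [he, List.mem_map] at h2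
      obtain ⟨e, he, heq⟩ := h2
      have h2 := (map_mem_edgeSet (P.reverse.edges_subset_edgeSet he)).1
      exact h.not_adj (heq ▸ h2 : s(a, ω) ∈ K.edgeSet)
  by_cases h1 : K.degree a = 1
  · have ha : a ∉ q.support := fun h2 => hs a h2 h1 rfl
    have hαa := h.le (hα.1 h1)
    refine ⟨Walk.cons hαa.symm (Walk.cons h.adj q), ⟨?_, ⟨(a, ω), h.adj⟩, by simp, rfl, rfl⟩,
      by simp [h1, hl]⟩
    rw [Walk.cons_isCycle_iff, Walk.cons_isPath_iff, Walk.edges_cons, List.mem_cons, not_or]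
    refine ⟨⟨hq, ha⟩, ?_, fun h2 => ha (q.snd_mem_support_of_mem_edges h2)⟩
    intro h2
    have hω : (α : V) = ω := by
      rcases Sym2.eq_iff.1 h2 with h3 | h3
      · exact absurd h3.1.symm hαa.ne
      · exact h3.1
    exact h.not_adj (hω ▸ hα.1 h1)
  · obtain ⟨α, hαc⟩ := α
    obtain rfl : α = a := hα.2 h1
    refine ⟨Walk.cons h.adj q, ⟨?_, ⟨(α, ω), h.adj⟩, by simp, rfl, rfl⟩, by simp [h1, hl]⟩
    rw [Walk.cons_isCycle_iff]
    exact ⟨hq, he⟩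

/-- Loops and paths to `ω` correspond up to a constant difference of lengths, so minimal loops give
geodesics. -/
lemma exists_geodesic_of_isMinimalLoop {α : coreVerts K a} (hα : IsBase K a α)
    (h : IsCompletion K a δ G ω) (hr : (core K a).Connected) {γ : G.Walk (α : V) α}
    (hγ : IsMinimalLoop a ω γ) :
    ∃ P : (core K a).Walk α ⟨ω, h.mem_coreVerts⟩,
      P.length = (core K a).dist α ⟨ω, h.mem_coreVerts⟩ ∧
      ∀ γ' : (core K a).Walk α α, commonPrefixLength γ.reverse.edges
        (γ'.map (Embedding.induce (coreVerts K a)).toHom).edges =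
          commonPrefixLength P.edges γ'.edges := by
  obtain ⟨P, t, ht, hl, hne⟩ := exists_walk_of_isLoopThrough hα h hγ.1
  refine ⟨P, le_antisymm ?_ (dist_le _), ?_⟩
  · obtain ⟨Q, hQ, hQl⟩ := (hr.preconnected α ⟨ω, h.mem_coreVerts⟩).exists_path_of_dist
    obtain ⟨γ', hγ', hl'⟩ := exists_isLoopThrough hα h hQ
    have h1 := hγ.2 γ' hγ'
    have h2 := congrArg List.length ht
    simp only [Walk.length_edges, List.length_append, List.length_map, Walk.length_reverse] at h2
    omega
  · intro γ'
    have hm : (γ'.map (Embedding.induce (coreVerts K a)).toHom).edges =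
        γ'.edges.map (Sym2.map Subtype.val) := Walk.edges_map _ _
    rw [ht, hm, commonPrefixLength_append_of_notMem,
      commonPrefixLength_map (Sym2.map.injective Subtype.val_injective)]
    intro e he hmem
    obtain ⟨e', he', heq⟩ := List.mem_map.1 hmem
    exact hne e he e' (γ'.edges_subset_edgeSet he') heq.symm

end Loops

variable {V : Type u} [Fintype V] {K G G' : SimpleGraph V} {a ω ω' : V} {δ : ℕ}

/-- The automorphism is extended by the identity to the pendant vertex, whose only neighbour in `K`
is the fixed vertex `α`. -/
lemma nonempty_iso_of_core_iso {α : coreVerts K a} (hα : IsBase K a α)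
    (h : IsCompletion K a δ G ω) (h' : IsCompletion K a δ G' ω') (σ : core K a ≃g core K a)
    (hσ : σ α = α) (hσω : σ ⟨ω, h.mem_coreVerts⟩ = ⟨ω', h'.mem_coreVerts⟩) :
    Nonempty (G ≃g G') := by
  let f : V ≃ V := Equiv.Perm.ofSubtype σ.toEquiv
  have hf : ∀ (x : V) (hx : x ∈ coreVerts K a), f x = σ ⟨x, hx⟩ :=
    fun x hx => Equiv.Perm.ofSubtype_apply_of_mem _ hx
  have hf' : ∀ x, x ∉ coreVerts K a → f x = x :=
    fun x hx => Equiv.Perm.ofSubtype_apply_of_not_mem _ hx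
  have hα' : f α = α := by rw [hf _ α.2, hσ]
  have hω : f ω = ω' := by rw [hf _ h.mem_coreVerts, hσω]
  have ha : f a = a := by
    by_cases h1 : K.degree a = 1
    · exact hf' a fun h2 => h2 h1 rfl
    · rw [← hα.2 h1, hα']
  have hpend : ∀ x, x ∉ coreVerts K a → ∀ y, K.Adj (f x) (f y) ↔ K.Adj x y := by
    intro x hx y
    obtain ⟨h1, rfl⟩ := notMem_coreVerts hx
    rw [ha]
    have hiff : ∀ z, K.Adj x z ↔ z = α := fun z =>
      ⟨hα.eq_of_adj h1, fun hz => hz ▸ hα.1 h1⟩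
    rw [hiff, hiff, ← f.apply_eq_iff_eq (x := y), hα']
  have hK : ∀ x y, K.Adj (f x) (f y) ↔ K.Adj x y := by
    intro x y
    by_cases hx : x ∈ coreVerts K a
    · by_cases hy : y ∈ coreVerts K a
      · rw [hf x hx, hf y hy]
        exact σ.map_adj_iff (v := ⟨x, hx⟩) (w := ⟨y, hy⟩)
      · rw [K.adj_comm, K.adj_comm x, hpend y hy]
    · exact hpend x hx y
  refine ⟨⟨f, ?_⟩⟩
  intro x y
  rw [h.adj_iff, h'.adj_iff, hK, ← f.apply_eq_iff_eq (x := x) (y := a),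
    ← f.apply_eq_iff_eq (x := y) (y := a), ← f.apply_eq_iff_eq (x := x) (y := ω),
    ← f.apply_eq_iff_eq (x := y) (y := ω), ha, hω]

end EdgeRecon

/-! ### Edge reconstruction of `G` -/

namespace EdgeRecon

open SimpleGraph Classical

variable {V : Type u} [Fintype V] {K G G' : SimpleGraph V} {a ω ω' : V}

/-- With `m` edges, the sum of the squared degrees enters the sum over the deck with the factor `m -
2`, which must not vanish. -/
lemma Standing.two_lt_card_edgeSet (hG : Standing G) : 2 < Fintype.card G.edgeSet := by
  obtain ⟨v⟩ := hG.connected.nonempty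
  have h2 : ∀ x, 2 ≤ G.degree x :=
    fun x => hG.two_le_minDegree.trans (G.minDegree_le_degree x)
  obtain ⟨b, -, hb⟩ := exists_adj_ne (h2 v) v
  obtain ⟨c, hcb, hc⟩ := exists_adj_ne (h2 v) b
  obtain ⟨d, hdv, hd⟩ := exists_adj_ne (h2 b) v
  rw [Fintype.two_lt_card_iff]
  refine ⟨⟨s(v, b), hb⟩, ⟨s(v, c), hc⟩, ⟨s(b, d), hd⟩, ?_, ?_, ?_⟩ <;>
    intro h <;> rcases Sym2.eq_iff.1 (congrArg Subtype.val h) with h | h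
  · exact hcb h.2.symm
  · exact hb.ne h.2.symm
  · exact hb.ne h.1
  · exact hdv h.1.symm
  · exact hb.ne h.1
  · exact hcb h.2

lemma Standing.isCompletion (hG : Standing G) (hKG : K = G.deleteEdges {s(a, ω)})
    (hadj : G.Adj a ω) (ha : K.degree a + 1 = G.minDegree) (h : SameEdgeDeck G G')
    (hadj' : G'.Adj a ω') (hK : K = G'.deleteEdges {s(a, ω')}) :
    IsCompletion K a G.minDegree G' ω' where
  adj := hadj'
  eq := hK
  two_le := hG.two_le_minDegree
  degree_base := ha
  le_degree := by
    intro x hx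
    have h1 := degree_deleteEdges hKG hadj x
    have h2 := G.minDegree_le_degree x
    by_contra hlt
    refine hx (hG.eq_of_degree hadj hKG ?_ ha)
    split_ifs at h1 <;> omega
  indep := fun _ _ huw hu => hG.not_adj_of_degree h huw hu

/-- A graph with the same edge deck as `G` is isomorphic to one that arises from the card
`G - aω` by adding an edge at `a`. -/
lemma Standing.exists_iso_sup_edge {V' : Type u} [Finite V'] {H : SimpleGraph V'}
    (hG : Standing G) (hKG : K = G.deleteEdges {s(a, ω)}) (hadj : G.Adj a ω)
    (ha : K.degree a + 1 = G.minDegree) (h : SameEdgeDeck G H) :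
    ∃ ω', Nonempty (H ≃g K ⊔ edge a ω') := by
  obtain ⟨f, hf⟩ := id h
  obtain ⟨φ⟩ := hf ⟨s(a, ω), hadj⟩
  have he' := (f ⟨s(a, ω), hadj⟩).2
  rw [← hKG] at φ
  generalize (f ⟨s(a, ω), hadj⟩).1 = e' at φ he'
  -- The other graph is transported to the vertices of `G`, so that its card becomes equal to `K`
  -- and not just isomorphic.
  obtain ⟨G₁, hG₁⟩ : ∃ G₁, G₁ = H.comap φ.toEquiv.toEmbedding := ⟨_, rfl⟩
  have ψ : G₁ ≃g H := hG₁ ▸ Iso.comap φ.toEquiv H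
  have hdeck := h.trans_iso ψ.symm
  obtain ⟨e, he⟩ : ∃ e, Sym2.map φ e = e' :=
    ⟨Sym2.map φ.symm e', by simp [Sym2.map_map]⟩
  have hK : K = G₁.deleteEdges {e} := by
    ext x y
    have h1 : H.Adj (φ x) (φ y) ↔ G₁.Adj x y := by rw [hG₁]; rfl
    have h2 : s(φ x, φ y) = e' ↔ s(x, y) = e := by
      refine (Eq.congr_right he.symm).trans ?_
      exact (Sym2.map.injective φ.injective).eq_iff (a := s(x, y)) (b := e)
    rw [← φ.map_adj_iff, deleteEdges_adj, deleteEdges_adj, Set.mem_singleton_iff,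
      Set.mem_singleton_iff, h1, h2]
  have heG : e ∈ G₁.edgeSet := by
    rw [← he] at he'
    induction e with
    | h x y => rw [hG₁]; exact he'
  -- Otherwise `a` would keep its degree `δ - 1`, which is too small for this deck.
  have hae : a ∈ e := by
    by_contra hae
    have h1 := degree_deleteEdges hK heG a
    rw [if_neg hae] at h1
    have h2 := hG.minDegree_le hdeck a
    omega
  obtain ⟨ω', rfl⟩ := hae
  have hc := hG.isCompletion hKG hadj ha hdeck heG hK
  have hsup : G₁ = K ⊔ edge a ω' := by
    ext x y
    rw [hc.adj_iff, sup_adj, edge_adj]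
    have := hc.adj.ne
    constructor
    · rintro (h1 | ⟨rfl, rfl⟩ | ⟨rfl, rfl⟩)
      · exact Or.inl h1
      · exact Or.inr ⟨Or.inl ⟨rfl, rfl⟩, this⟩
      · exact Or.inr ⟨Or.inr ⟨rfl, rfl⟩, this.symm⟩
    · tauto
  exact ⟨ω', ⟨hsup ▸ ψ.symm⟩⟩

/-- Otherwise nothing is added, and `K` has fewer edges than `G`. -/
lemma SameEdgeDeck.not_adj_of_sup_edge (hKG : K = G.deleteEdges {s(a, ω)}) (hadj : G.Adj a ω)
    (h : SameEdgeDeck G (K ⊔ edge a ω')) : a ≠ ω' ∧ ¬ K.Adj a ω' := by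
  have hne : K ⊔ edge a ω' ≠ K := by
    intro heq
    rw [heq] at h
    obtain ⟨f, -⟩ := h
    have hlt : K.edgeSet ⊂ G.edgeSet := by
      rw [hKG, edgeSet_deleteEdges]
      refine ⟨Set.sdiff_subset, fun hsub => ?_⟩
      exact (hsub (show s(a, ω) ∈ G.edgeSet from hadj)).2 rfl
    have h1 := Set.ncard_lt_ncard hlt (Set.toFinite _)
    have h2 := Nat.card_congr f
    rw [Nat.card_coe_set_eq, Nat.card_coe_set_eq] at h2
    omega
  constructor
  · rintro rfl
    exact hne (sup_edge_self _ _)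
  · intro h1
    exact hne (sup_edge_of_adj _ h1)

theorem Standing.edgeReconstructible (hG : Standing G) (he : IsMissingEdge G a ω)
    (α : coreVerts (card G a ω) a) (hα : IsBase (card G a ω) a α)
    (γ₀ : G.Walk (α : V) α) (hγ₀ : IsMinimalLoop a ω γ₀)
    (hrec : OverlapsReconstructible G a ω α γ₀) : EdgeReconstructible G := by
  intro V' _ H hH
  obtain ⟨hadj, ha⟩ := he
  have hKG : card G a ω = G.deleteEdges {s(a, ω)} := rfl
  obtain ⟨ω₁, ⟨φ⟩⟩ := hG.exists_iso_sup_edge hKG hadj ha hH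
  obtain ⟨ω₂, ⟨ψ⟩, γ, hγ, hov⟩ := hrec ω₁ (hH.trans_iso φ)
  have hdeck := (hH.trans_iso φ).trans_iso ψ
  obtain ⟨hne, hnadj⟩ := hdeck.not_adj_of_sup_edge hKG hadj
  have hK : (card G a ω).Connected := hG.card_connected _ hadj
  clear hrec
  unfold SameOverlaps at hov
  generalize card G a ω = K at *
  have hK₂ : K = (K ⊔ edge a ω₂).deleteEdges {s(a, ω₂)} := by
    ext x y
    rw [deleteEdges_adj, sup_adj, edge_adj, Set.mem_singleton_iff, Sym2.eq_iff]
    constructor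
    · refine fun h => ⟨Or.inl h, ?_⟩
      rintro (⟨rfl, rfl⟩ | ⟨rfl, rfl⟩)
      exacts [hnadj h, hnadj h.symm]
    · tauto
  have hadj₂ : (K ⊔ edge a ω₂).Adj a ω₂ := by
    rw [sup_adj, edge_adj]
    exact Or.inr ⟨Or.inl ⟨rfl, rfl⟩, hne⟩
  have c := hG.isCompletion hKG hadj ha (SameEdgeDeck.refl G) hadj hKG
  have c₂ := hG.isCompletion hKG hadj ha hdeck hadj₂ hK₂
  have hdeg : K.degree ω₂ = K.degree ω := by
    have h1 := hdeck.degreeSquareSum_eq hG.two_lt_card_edgeSet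
    rw [degreeSquareSum_deleteEdges hKG hadj, degreeSquareSum_deleteEdges hK₂ hadj₂] at h1
    omega
  have R := reduced_core hα hK hG.no_cut_vertex c c₂ hdeg
  obtain ⟨P, hP, hPo⟩ := exists_geodesic_of_isMinimalLoop hα c R.connected hγ₀
  obtain ⟨P₂, hP₂, hPo₂⟩ := exists_geodesic_of_isMinimalLoop hα c₂ R.connected hγ
  -- The overlaps that enter are those of the inverse loops, which start with the geodesics.
  obtain ⟨σ, hσ, hσω⟩ := exists_iso_of_overlapsAgree R hP hP₂ fun v hv T hT hs d γ' hγ' => by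
    rw [← hPo, ← hPo₂]
    exact (hov v hv T hT hs d γ' hγ').2
  obtain ⟨τ⟩ := nonempty_iso_of_core_iso hα c c₂ σ hσ hσω
  exact ⟨τ.trans (ψ.symm.trans φ.symm)⟩

end EdgeRecon

theorem theorem4 {V : Type u} [Fintype V] (G : SimpleGraph V) (hG : EdgeRecon.Standing G)
    (a ω : V) (he : EdgeRecon.IsMissingEdge G a ω)
    (α : EdgeRecon.coreVerts (EdgeRecon.card G a ω) a)
    (hα : EdgeRecon.IsBase (EdgeRecon.card G a ω) a α)
    (γ₀ : G.Walk (α : V) α) (hγ₀ : EdgeRecon.IsMinimalLoop a ω γ₀)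
    (hrec : EdgeRecon.OverlapsReconstructible G a ω α γ₀) :
    EdgeRecon.EdgeReconstructible G :=
  hG.edgeReconstructible he α hα γ₀ hγ₀ hrec
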